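/- Let $\mathbb H$ be the real quaternions, let $\mathrm{SL}_n(\mathbb H)$ be the group of matrices in $\mathrm{GL}_n(\mathbb H)$ of reduced norm $1$, and let $\mathfrak{sl}_n(\mathbb H)$ be the real Lie algebra of matrices in $\mathrm M_n(\mathbb H)$ of reduced trace $0$. Let $V=\mathbb H^n$ be the right $\mathbb H$-vector space of column vectors. For elements $X,H,Y\in\mathfrak{sl}_n(\mathbb H)$ forming an $\mathfrak{sl}_2(\mathbb R)$-triple ($X\neq 0$, $[H,X]=2X$, $[H,Y]=-2Y$, $[X,Y]=H$) and $d\ge 1$, let $M(d-1)\subseteq V$ be the sum of all irreducible $\mathrm{Span}_{\mathbb R}\{X,H,Y\}$-submodules of $V$ of real dimension $d$, and let $L(d-1)=\{v\in M(d-1): Yv=0\}$, which is an $\mathbb H$-subspace of $V$. The orbit $\mathcal O_X=\{gXg^{-1}: g\in\mathrm{SL}_n(\mathbb H)\}$ of a non-zero nilpotent element $X$ (one for which $\mathrm{ad}\,X$ is a nilpotent operator) is said to correspond to the partition $\mathbf d=[d_1^{t_{d_1}},\dots,d_s^{t_{d_s}}]$ of $n$ in which each $d\geq 1$ has multiplicity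 $t_d=\dim_{\mathbb H}L(d-1)$, computed from an $\mathfrak{sl}_2(\mathbb R)$-triple whose first member lies in $\mathcal O_X$. Put $\mathbb N_{\mathbf d}=\{d_1,\dots,d_s\}$. For $t,d\ge 1$, let $\mathrm{GL}_t(\mathbb H)^d_\Delta$ be the diagonally embedded copy of $\mathrm{GL}_t(\mathbb H)$ in the $d$-fold product $\mathrm{GL}_t(\mathbb H)^d$, regarded as the group of block diagonal matrices $g\oplus\cdots\oplus g$ ($d$ blocks) in $\mathrm{GL}_{td}(\mathbb H)$. For matrix groups $H_i\subseteq \mathrm{GL}_{m_i}(\mathbb H)$, let $S(\prod_i H_i)$ be the subgroup of all $(h_i)\in\prod_i H_i$ with $\prod_i\mathrm{Nrd}(h_i)=1$, where $\mathrm{Nrd}$ is the reduced norm of $\mathrm M_{m_i}(\mathbb H)$. **Proposition.** Let $X\in\mathfrak{sl}_n(\mathbb H)$ be a non-zero nilpotent element, let $\{X,H,Y\}$ be an $\mathfrak{sl}_2(\mathbb R)$-triple in $\mathfrak{sl}_n(\mathbb H)$, and let the nilpotent orbit $\mathcal O_X$ correspond to the partition $\mathbf d$ of $n$. Then the centralizer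 $\mathcal Z_{\mathrm{SL}_n(\mathbb H)}(X,H,Y)=\{g\in\mathrm{SL}_n(\mathbb H): gZg^{-1}=Z \text{ for } Z\in\{X,H,Y\}\}$ satisfies $$\mathcal Z_{\mathrm{SL}_n(\mathbb H)}(X,H,Y)\;\simeq\; S\Big(\prod_{d\in\mathbb N_{\mathbf d}}\mathrm{GL}_{t_d}(\mathbb H)^d_\Delta\Big),$$ where $\simeq$ denotes an isomorphism of topological groups. -/

import Mathlib

open scoped Quaternion Matrix MulOpposite

attribute [local instance 100] LieRing.ofAssociativeRing

noncomputable section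

namespace QuaternionicNilpotent

/-! ### Reduced norm and reduced trace of quaternionic matrices -/

/-- The standard embedding of the quaternions in the complex `2 × 2` matrices,
`a + b i + c j + d k ↦ !![a + b i, c + d i; -c + d i, a - b i]`. -/
def quatToComplex : ℍ[ℝ] →+* Matrix (Fin 2) (Fin 2) ℂ where
  toFun q := !![⟨q.re, q.imI⟩, ⟨q.imJ, q.imK⟩; ⟨-q.imJ, q.imK⟩, ⟨q.re, -q.imI⟩]
  map_zero' := by
    ext i j
    fin_cases i <;> fin_cases j <;> simp [Complex.ext_iff]
  map_one' := by
    ext i j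
    fin_cases i <;> fin_cases j <;> simp [Complex.ext_iff]
  map_add' p q := by
    ext i j
    fin_cases i <;> fin_cases j <;> simp [Complex.ext_iff] <;> ring
  map_mul' p q := by
    ext i j
    fin_cases i <;> fin_cases j <;>
      simp [Complex.ext_iff, Matrix.mul_apply, Fin.sum_univ_two] <;> constructor <;> ring

section

variable {ι : Type*} [Fintype ι] [DecidableEq ι]

/-- The embedding of `M_ι(ℍ)` in `M_{ι × 2}(ℂ)`; it identifies `M_ι(ℍ) ⊗_ℝ ℂ` with
`M_{ι × 2}(ℂ)`. -/
def matToComplex : Matrix ι ι ℍ[ℝ] →+* Matrix (ι × Fin 2) (ι × Fin 2) ℂ :=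
  (Matrix.compRingEquiv ι (Fin 2) ℂ).toRingHom.comp quatToComplex.mapMatrix

/-- The reduced norm of the central simple `ℝ`-algebra `M_ι(ℍ)`. Its values lie in the centre `ℝ`
of the algebra, seen here inside `ℂ`. -/
def nrd : Matrix ι ι ℍ[ℝ] →* ℂ :=
  Matrix.detMonoidHom.comp (matToComplex (ι := ι)).toMonoidHom

/-- The reduced trace of the central simple `ℝ`-algebra `M_ι(ℍ)`. -/
def trd (A : Matrix ι ι ℍ[ℝ]) : ℂ := (matToComplex A).trace

theorem trd_mul_comm (A B : Matrix ι ι ℍ[ℝ]) : trd (A * B) = trd (B * A) := by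
  simp only [trd, map_mul]
  exact Matrix.trace_mul_comm _ _

theorem trd_zero : trd (0 : Matrix ι ι ℍ[ℝ]) = 0 := by simp [trd]

theorem trd_add (A B : Matrix ι ι ℍ[ℝ]) : trd (A + B) = trd A + trd B := by simp [trd]

theorem trd_sub (A B : Matrix ι ι ℍ[ℝ]) : trd (A - B) = trd A - trd B := by simp [trd]

theorem trd_smul (r : ℝ) (A : Matrix ι ι ℍ[ℝ]) : trd (r • A) = (r : ℂ) * trd A := by
  simp only [trd, Matrix.trace, Matrix.diag, Finset.mul_sum]
  refine Finset.sum_congr rfl fun x _ => ?_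
  obtain ⟨i, j⟩ := x
  simp only [matToComplex, quatToComplex, RingEquiv.toRingHom_eq_coe, RingHom.coe_comp,
    RingHom.coe_coe, Function.comp_apply, RingHom.mapMatrix_apply, Matrix.compRingEquiv_apply,
    Matrix.comp_apply, Matrix.map_apply, Matrix.smul_apply]
  fin_cases j <;> simp [Complex.ext_iff]

end

/-! ### The Lie algebra `𝔰𝔩_n(ℍ)` and the group `SL_n(ℍ)` -/

/-- `𝔰𝔩_n(ℍ)`: quaternionic matrices of reduced trace zero. -/
def sl (n : ℕ) : LieSubalgebra ℝ (Matrix (Fin n) (Fin n) ℍ[ℝ]) where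
  carrier := {A | trd A = 0}
  zero_mem' := trd_zero
  add_mem' {A B} hA hB := by
    simp only [Set.mem_ofPred_eq] at hA hB ⊢
    rw [trd_add, hA, hB, add_zero]
  smul_mem' r A hA := by
    simp only [Set.mem_ofPred_eq] at hA ⊢
    rw [trd_smul, hA, mul_zero]
  lie_mem' {A B} _ _ := by
    change trd (A * B - B * A) = 0
    rw [trd_sub, trd_mul_comm, sub_self]

/-- `SL_n(ℍ)`: quaternionic matrices of reduced norm one. -/
def SL (n : ℕ) : Subgroup (Matrix.GeneralLinearGroup (Fin n) ℍ[ℝ]) :=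
  ((nrd (ι := Fin n)).comp (Units.coeHom (Matrix (Fin n) (Fin n) ℍ[ℝ]))).ker

variable {n : ℕ}

/-- The adjoint action `Ad(g) Z = g Z g⁻¹` of `SL_n(ℍ)` on `𝔰𝔩_n(ℍ)`. -/
def Ad (g : SL n) (Z : sl n) : sl n :=
  ⟨((g : Matrix.GeneralLinearGroup (Fin n) ℍ[ℝ]) : Matrix (Fin n) (Fin n) ℍ[ℝ]) * Z *
      ((g⁻¹ : SL n) : Matrix.GeneralLinearGroup (Fin n) ℍ[ℝ]), by
    change trd _ = 0
    rw [trd_mul_comm, ← mul_assoc, ← Units.val_mul, ← Subgroup.coe_mul, inv_mul_cancel,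
      Subgroup.coe_one, Units.val_one, one_mul]
    exact Z.2⟩

theorem Ad_one (Z : sl n) : Ad 1 Z = Z := by
  ext1
  simp [Ad]

theorem Ad_mul (g h : SL n) (Z : sl n) : Ad (g * h) Z = Ad g (Ad h Z) := by
  ext1
  simp [Ad, mul_assoc]

/-- The centralizer `{h ∈ SL_n(ℍ) | Ad(h) Z = Z for all Z ∈ S}` of a subset `S ⊆ 𝔰𝔩_n(ℍ)`. -/
def centralizer (S : Set (sl n)) : Subgroup (SL n) where
  carrier := {h | ∀ Z ∈ S, Ad h Z = Z}
  one_mem' Z _ := Ad_one Z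
  mul_mem' {g h} hg hh Z hZ := by rw [Ad_mul, hh Z hZ, hg Z hZ]
  inv_mem' {g} hg Z hZ := by
    conv_lhs => rw [← hg Z hZ]
    rw [← Ad_mul, inv_mul_cancel, Ad_one]

/-- The adjoint orbit of `X` under `SL_n(ℍ)`. -/
def orbit (X : sl n) : Set (sl n) := {Z | ∃ g : SL n, Ad g X = Z}

/-! ### The partition attached to a nilpotent orbit

`V = ℍⁿ` is the space of column vectors, a right vector space over `ℍ` (that is, a module over
`ℍᵐᵒᵖ`) on which matrices act from the left. -/

/-- `A` is stable under `X`, `H` and `Y`. -/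
def IsInvariant (X H Y : sl n) (A : Submodule ℝ (Fin n → ℍ[ℝ])) : Prop :=
  ∀ v ∈ A, X.1 *ᵥ v ∈ A ∧ H.1 *ᵥ v ∈ A ∧ Y.1 *ᵥ v ∈ A

/-- `A` is an irreducible submodule of `V = ℍⁿ` for the real span of `X`, `H`, `Y`. -/
structure IsIrreducibleSubmodule (X H Y : sl n) (A : Submodule ℝ (Fin n → ℍ[ℝ])) : Prop where
  ne_bot : A ≠ ⊥
  invariant : IsInvariant X H Y A
  eq_bot_or_eq : ∀ B : Submodule ℝ (Fin n → ℍ[ℝ]), B ≤ A → IsInvariant X H Y B → B = ⊥ ∨ B = A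

/-- The isotypical component `M(d-1)`: the sum of all irreducible submodules of real
dimension `d`. -/
def isotypic (X H Y : sl n) (d : ℕ) : Submodule ℝ (Fin n → ℍ[ℝ]) :=
  sSup {A | IsIrreducibleSubmodule X H Y A ∧ Module.finrank ℝ A = d}

/-- Right multiplication by a nonzero quaternion, as a real linear automorphism of `V`. -/
def rightMul (q : ℍ[ℝ]) (hq : q ≠ 0) : (Fin n → ℍ[ℝ]) ≃ₗ[ℝ] (Fin n → ℍ[ℝ]) where
  toFun v := MulOpposite.op q • v
  map_add' v w := smul_add _ v w
  map_smul' r v := smul_comm _ r v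
  invFun v := MulOpposite.op q⁻¹ • v
  left_inv v := by
    ext1 i
    simp [hq]
  right_inv v := by
    ext1 i
    simp [hq]

theorem IsInvariant.map {X H Y : sl n} {A : Submodule ℝ (Fin n → ℍ[ℝ])}
    (hA : IsInvariant X H Y A) (q : ℍ[ℝ]) (hq : q ≠ 0) :
    IsInvariant X H Y (A.map (rightMul q hq).toLinearMap) := by
  rintro _ ⟨v, hv, rfl⟩
  obtain ⟨h1, h2, h3⟩ := hA v hv
  refine ⟨⟨_, h1, ?_⟩, ⟨_, h2, ?_⟩, ⟨_, h3, ?_⟩⟩ <;>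
    exact (Matrix.mulVec_smul _ (MulOpposite.op q) v).symm

theorem rightMul_inv_map (q : ℍ[ℝ]) (hq : q ≠ 0) (A : Submodule ℝ (Fin n → ℍ[ℝ])) :
    (A.map (rightMul q hq).toLinearMap).map (rightMul q⁻¹ (inv_ne_zero hq)).toLinearMap = A := by
  have : (rightMul (n := n) q⁻¹ (inv_ne_zero hq)).toLinearMap ∘ₗ (rightMul q hq).toLinearMap
      = LinearMap.id := by
    exact LinearMap.ext fun v => (rightMul q hq).left_inv v
  rw [← Submodule.map_comp, this, Submodule.map_id]

theorem IsIrreducibleSubmodule.map {X H Y : sl n} {A : Submodule ℝ (Fin n → ℍ[ℝ])}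
    (hA : IsIrreducibleSubmodule X H Y A) (q : ℍ[ℝ]) (hq : q ≠ 0) :
    IsIrreducibleSubmodule X H Y (A.map (rightMul q hq).toLinearMap) where
  ne_bot h := hA.ne_bot (by rw [← rightMul_inv_map q hq A, h, Submodule.map_bot])
  invariant := hA.invariant.map q hq
  eq_bot_or_eq B hB hB' := by
    have key : (B.map (rightMul q⁻¹ (inv_ne_zero hq)).toLinearMap).map
        (rightMul q hq).toLinearMap = B := by
      have := rightMul_inv_map q⁻¹ (inv_ne_zero hq) B
      simpa only [inv_inv] using this
    have hle : B.map (rightMul q⁻¹ (inv_ne_zero hq)).toLinearMap ≤ A := by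
      rw [← rightMul_inv_map q hq A]
      exact Submodule.map_mono hB
    rcases hA.eq_bot_or_eq _ hle (hB'.map q⁻¹ (inv_ne_zero hq)) with h | h
    · left
      rw [← key, h, Submodule.map_bot]
    · right
      rw [← key, h]

theorem op_smul_mem_isotypic (X H Y : sl n) (d : ℕ) (q : ℍ[ℝ]) {v : Fin n → ℍ[ℝ]}
    (hv : v ∈ isotypic X H Y d) : MulOpposite.op q • v ∈ isotypic X H Y d := by
  by_cases hq : q = 0
  · subst hq
    simp
  · have h : isotypic X H Y d ≤ (isotypic X H Y d).comap (rightMul q hq).toLinearMap := by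
      refine sSup_le fun A hA => ?_
      rw [← Submodule.map_le_iff_le_comap]
      refine le_sSup ⟨hA.1.map q hq, ?_⟩
      rw [← hA.2]
      exact LinearEquiv.finrank_map_eq (rightMul q hq) A
    exact h hv

/-- `L(d-1) = {v ∈ M(d-1) | Y v = 0}`, a right `ℍ`-subspace of `V`. -/
def lowest (X H Y : sl n) (d : ℕ) : Submodule (ℍ[ℝ])ᵐᵒᵖ (Fin n → ℍ[ℝ]) where
  carrier := {v | Y.1 *ᵥ v = 0 ∧ v ∈ isotypic X H Y d}
  zero_mem' := ⟨Matrix.mulVec_zero _, Submodule.zero_mem _⟩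
  add_mem' {v w} hv hw :=
    ⟨by rw [Matrix.mulVec_add, hv.1, hw.1, add_zero], Submodule.add_mem _ hv.2 hw.2⟩
  smul_mem' c v hv :=
    ⟨by rw [Matrix.mulVec_smul, hv.1, smul_zero], op_smul_mem_isotypic X H Y d c.unop hv.2⟩

/-- The orbit `O` corresponds to the partition `p` of `n`: either `O` is the orbit of `0` and
`p = [1ⁿ]`, or, for some `𝔰𝔩₂`-triple `(X, H, Y)` with `X ∈ O`, every `d ≥ 1` occurs in `p` with
multiplicity `t_d = dim_ℍ L(d-1)`. -/
def CorrespondsTo (O : Set (sl n)) (p : n.Partition) : Prop :=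
  ((0 : sl n) ∈ O ∧ p.parts = Multiset.replicate n 1) ∨
    ∃ X ∈ O, ∃ H Y : sl n, IsSl2Triple H X Y ∧
      ∀ d : ℕ, 1 ≤ d → p.parts.count d = Module.finrank (ℍ[ℝ])ᵐᵒᵖ (lowest X H Y d)

/-! ### The group `S(∏_d GL_{t_d}(ℍ)^d_Δ)` -/

/-- `GL_t(ℍ)^d_Δ`: the diagonal copy of `GL_t(ℍ)` in the `d`-fold product of `GL_t(ℍ)`, as the
group of block diagonal matrices `g ⊕ ⋯ ⊕ g` (`d` blocks) acting on `(ℍᵗ)ᵈ`. -/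
def diagGL (t d : ℕ) : Subgroup (Matrix.GeneralLinearGroup (Fin t × Fin d) ℍ[ℝ]) :=
  (Units.map ((Matrix.blockDiagonalRingHom (Fin t) (Fin d) ℍ[ℝ]).comp
    (Pi.constRingHom (Fin d) (Matrix (Fin t) (Fin t) ℍ[ℝ]))).toMonoidHom).range

/-- `S(∏ᵢ Hᵢ)`: the families `(hᵢ)` in `∏ᵢ Hᵢ` with `∏ᵢ Nrd(hᵢ) = 1`, for matrix groups
`Hᵢ ⊆ GL_{κ i}(ℍ)`. -/
def specialProd {ι : Type*} [Fintype ι] {κ : ι → Type*} [∀ i, Fintype (κ i)]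
    [∀ i, DecidableEq (κ i)] (G : ∀ i, Subgroup (Matrix.GeneralLinearGroup (κ i) ℍ[ℝ])) :
    Subgroup (∀ i, G i) where
  carrier := {h | ∏ i, nrd ((h i : Matrix.GeneralLinearGroup (κ i) ℍ[ℝ]) :
    Matrix (κ i) (κ i) ℍ[ℝ]) = 1}
  one_mem' := by simp
  mul_mem' {g h} hg hh := by
    simp only [Set.mem_ofPred_eq] at hg hh ⊢
    simp [Finset.prod_mul_distrib, hg, hh]
  inv_mem' {g} hg := by
    simp only [Set.mem_ofPred_eq] at hg ⊢
    have h : (∏ i, nrd (g i).1.1) * (∏ i, nrd (g⁻¹ i).1.1) = 1 := by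
      rw [← Finset.prod_mul_distrib]
      refine Finset.prod_eq_one fun i _ => ?_
      rw [← map_mul, ← Units.val_mul, ← Subgroup.coe_mul, Pi.inv_apply, mul_inv_cancel]
      simp
    rwa [hg, one_mul] at h

end QuaternionicNilpotent

end

/-! Choose an `ℍ`-basis `β_{d,i}` of each `L(d-1)`. The vectors `X^k β_{d,i}` with `k < d` form an
`ℍ`-basis of `V = ℍⁿ`. A matrix commuting with `H` and `Y` preserves every `L(d-1)`; if it also
commutes with `X`, it acts on all layers `X^k L(d-1)` by one and the same matrix `a_d`. Conversely,
every choice of the `a_d` gives a matrix commuting with the triple. In this basis the centralizer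
therefore consists of block matrices `⊕_d (a_d ⊕ ⋯ ⊕ a_d)`, and the change of basis respects the
reduced norm and the topology (`exists_repeatedBlocks_of_commute`, `commute_of_mul_basisMatrix_eq`,
`centralizer_continuousMulEquiv_specialProd`).

The basis rests on complete reducibility, obtained here from polynomial identities. Since `X` and
`Y` are nilpotent, `H` is diagonalizable on `ker Y` with eigenvalues among `0, -1, -2, …`. It
follows that the generalized eigenspaces of the Casimir operator for the values `d ^ 2 - 1` span
`V`, and on each of them weights are confined between `1 - d` and `d - 1` (`span_strings_eq_top`,
`X_pow_eq_zero_of_sum_eq_zero`). The same facts identify `L(d-1)` with the lowest weight vectors of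
weight `1 - d` (`mem_lowest_iff`).

The partition may come from a triple other than the given one. As `rank X^m = ∑ t_d max(d - m, 0)`,
the multiplicities depend only on the conjugacy class of `X` (`finrank_lowest_eq_of_conj`), so
conjugacy of triples is not needed. -/

noncomputable section

namespace QuaternionicNilpotent

/-! ### Polynomials in a linear operator. -/

section Algebra

open Polynomial

variable {k V : Type*} [Field k] [AddCommGroup V] [Module k V]

/-- Allowing `a ≠ b` covers weight shifts such as `H Y^m = Y^m (H - 2m)` as well as plain
commutation. -/
theorem aeval_mul_of_mul_eq {A : Type*} [Ring A] [Algebra k A] {a b y : A} (h : a * y = y * b)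
    (p : k[X]) : aeval a p * y = y * aeval b p := by
  induction p using Polynomial.induction_on' with
  | add p q hp hq => rw [map_add, map_add, add_mul, mul_add, hp, hq]
  | monomial n c =>
    have hn : a ^ n * y = y * b ^ n := by
      induction n with
      | zero => simp
      | succ n ih => rw [pow_succ, mul_assoc, h, ← mul_assoc, ih, mul_assoc, ← pow_succ]
    rw [aeval_monomial, aeval_monomial, mul_assoc, hn, ← mul_assoc, Algebra.commutes, mul_assoc]

theorem aeval_apply_of_apply_eq_smul {f : Module.End k V} {v : V} {μ : k} (h : f v = μ • v)
    (p : k[X]) : aeval f p v = p.eval μ • v := by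
  induction p using Polynomial.induction_on' with
  | add p q hp hq => rw [map_add, LinearMap.add_apply, hp, hq, eval_add, add_smul]
  | monomial n c =>
    have hn : (f ^ n) v = μ ^ n • v := by
      induction n with
      | zero => simp
      | succ n ih => rw [pow_succ', Module.End.mul_apply, ih, map_smul, h, smul_smul, pow_succ]
    rw [aeval_monomial, Module.End.mul_apply, hn, eval_monomial, mul_smul]
    simp [Module.algebraMap_end_apply, smul_comm c]

/-- Meant for `W = ker Y`, where the Casimir operator agrees with a polynomial in `H`. -/
theorem aeval_apply_eq_of_eqOn {f g : Module.End k V} {W : Submodule k V}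
    (hfg : ∀ u ∈ W, f u = g u) (hg : ∀ u ∈ W, g u ∈ W) (p : k[X]) {u : V} (hu : u ∈ W) :
    aeval f p u = aeval g p u := by
  induction p using Polynomial.induction_on' with
  | add p q hp hq => rw [map_add, map_add, LinearMap.add_apply, hp, hq, LinearMap.add_apply]
  | monomial n c =>
    have hn : (f ^ n) u = (g ^ n) u ∧ (g ^ n) u ∈ W := by
      induction n with
      | zero => simpa using hu
      | succ n ih =>
        rw [pow_succ', pow_succ', Module.End.mul_apply, Module.End.mul_apply, ih.1]
        exact ⟨hfg _ ih.2, hg _ ih.2⟩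
    rw [aeval_monomial, aeval_monomial, Module.End.mul_apply, Module.End.mul_apply, hn.1]

/-- Replaces comparison of weights for vectors not yet known to be sums of eigenvectors. -/
theorem eq_zero_of_isCoprime_aeval {f : Module.End k V} {p q : k[X]} (hpq : IsCoprime p q) {v : V}
    (hp : aeval f p v = 0) (hq : aeval f q v = 0) : v = 0 := by
  have := (disjoint_ker_aeval_of_isCoprime f hpq).le_bot (x := v) ⟨hp, hq⟩
  simpa using this

theorem isCoprime_X_sub_C {a b : k} (h : a ≠ b) :
    IsCoprime (Polynomial.X - C a) (Polynomial.X - C b) :=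
  isCoprime_X_sub_C_of_isUnit_sub (sub_ne_zero.2 h).isUnit

theorem mem_iSup_ker_of_aeval_prod {f : Module.End k V} {ι : Type*} [DecidableEq ι]
    (p : ι → k[X]) (s : Finset ι) (hp : ∀ i ∈ s, ∀ j ∈ s, i ≠ j → IsCoprime (p i) (p j)) :
    LinearMap.ker (aeval f (∏ i ∈ s, p i)) ≤ ⨆ i ∈ s, LinearMap.ker (aeval f (p i)) := by
  induction s using Finset.induction_on with
  | empty => intro v; simp
  | insert a s ha ih =>
    rw [Finset.prod_insert ha, ← sup_ker_aeval_eq_ker_aeval_mul_of_coprime, Finset.iSup_insert]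
    · exact sup_le_sup_left (ih fun i hi j hj => hp i (Finset.mem_insert_of_mem hi) j
        (Finset.mem_insert_of_mem hj)) _
    · refine IsCoprime.prod_right fun i hi => hp _ (Finset.mem_insert_self _ _) _
        (Finset.mem_insert_of_mem hi) ?_
      rintro rfl
      exact ha hi

/-- The monic polynomial with roots `r 0, …, r (m - 1)`. -/
def rootPoly (r : ℕ → k) (m : ℕ) : k[X] := ∏ j ∈ Finset.range m, (Polynomial.X - C (r j))

theorem rootPoly_succ (r : ℕ → k) (m : ℕ) :
    rootPoly r (m + 1) = rootPoly r m * (Polynomial.X - C (r m)) :=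
  Finset.prod_range_succ _ _

theorem isCoprime_rootPoly {r s : ℕ → k} (h : ∀ i j, r i ≠ s j) (m l : ℕ) :
    IsCoprime (rootPoly r m) (rootPoly s l) :=
  IsCoprime.prod_left fun i _ => IsCoprime.prod_right fun j _ => isCoprime_X_sub_C (h i j)

theorem rootPoly_comp (r : ℕ → k) (m : ℕ) (c : k) :
    (rootPoly r m).comp (Polynomial.X - C c) = rootPoly (fun j => r j + c) m := by
  simp only [rootPoly, Polynomial.prod_comp]
  refine Finset.prod_congr rfl fun j _ => ?_
  simp only [sub_comp, X_comp, C_comp, map_add]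
  ring

theorem aeval_X_sub_C_apply (f : Module.End k V) (c : k) (v : V) :
    aeval f (Polynomial.X - C c) v = f v - c • v := by
  simp [Module.algebraMap_end_apply]

end Algebra

/-! ### Representations of `𝔰𝔩₂` through the Casimir operator. -/

section Sl2

open Polynomial

variable {k V : Type*} [Field k] [AddCommGroup V] [Module k V]

/-- The commutation relations of an `𝔰𝔩₂`-triple of endomorphisms. -/
structure IsSl2Rel (X H Y : Module.End k V) : Prop where
  hx : ∀ v, H (X v) = X (H v) + (2 : k) • X v
  hy : ∀ v, H (Y v) = Y (H v) - (2 : k) • Y v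
  xy : ∀ v, X (Y v) = Y (X v) + H v

/-- The Casimir operator, normalized to act by `d ^ 2 - 1` on the `d`-dimensional irreducible
module. -/
def casimir (X H Y : Module.End k V) : Module.End k V :=
  H * H - (2 : k) • H + (4 : k) • (X * Y)

theorem casimir_apply (X H Y : Module.End k V) (v : V) :
    casimir X H Y v = H (H v) - (2 : k) • H v + (4 : k) • X (Y v) := rfl

/-- The space of lowest weight vectors of weight `1 - d`. -/
def lowestWeight (H Y : Module.End k V) (d : ℕ) : Submodule k V where
  carrier := {v | Y v = 0 ∧ H v = (1 - d : k) • v}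
  zero_mem' := by simp
  add_mem' {v w} hv hw := by
    constructor
    · rw [map_add, hv.1, hw.1, add_zero]
    · rw [map_add, hv.2, hw.2, smul_add]
  smul_mem' c v hv := by
    constructor
    · rw [map_smul, hv.1, smul_zero]
    · rw [map_smul, hv.2, smul_comm]

theorem mem_lowestWeight {H Y : Module.End k V} {d : ℕ} {v : V} :
    v ∈ lowestWeight H Y d ↔ Y v = 0 ∧ H v = (1 - d : k) • v := Iff.rfl

namespace IsSl2Rel

variable {X H Y : Module.End k V}

/-- This symmetry fixes the Casimir operator, so each result about `Y` and low weights yields one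
about `X` and high weights. -/
theorem symm (T : IsSl2Rel X H Y) : IsSl2Rel Y (-H) X where
  hx v := by
    simp only [LinearMap.neg_apply, map_neg, T.hy]
    module
  hy v := by
    simp only [LinearMap.neg_apply, map_neg, T.hx]
    module
  xy v := by
    simp only [LinearMap.neg_apply, T.xy]
    module

theorem casimir_symm (T : IsSl2Rel X H Y) : casimir Y (-H) X = casimir X H Y := by
  ext v
  simp only [casimir_apply, LinearMap.neg_apply, map_neg, T.xy]
  module

theorem commute_casimir_X (T : IsSl2Rel X H Y) : casimir X H Y * X = X * casimir X H Y := by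
  ext v
  have e : Y (X v) = X (Y v) - H v := by rw [T.xy]; abel
  simp only [Module.End.mul_apply, casimir_apply, T.hx, map_add, map_smul, map_sub, e]
  module

theorem commute_casimir_Y (T : IsSl2Rel X H Y) : casimir X H Y * Y = Y * casimir X H Y := by
  rw [← T.casimir_symm]
  exact T.symm.commute_casimir_X

theorem commute_casimir_H (T : IsSl2Rel X H Y) : casimir X H Y * H = H * casimir X H Y := by
  ext v
  simp only [Module.End.mul_apply, casimir_apply, T.hx, T.hy, map_add, map_smul, map_sub]
  module

theorem casimir_of_mem_lowestWeight {d : ℕ} {v : V}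
    (hv : v ∈ lowestWeight H Y d) : casimir X H Y v = ((d : k) ^ 2 - 1) • v := by
  simp only [casimir_apply, hv.1, hv.2, map_smul, map_zero]
  module

theorem mul_Y_pow (T : IsSl2Rel X H Y) (m : ℕ) :
    H * Y ^ m = Y ^ m * aeval H (Polynomial.X - C (2 * m : k)) := by
  induction m with
  | zero => simp
  | succ m ih =>
    ext v
    have := congrArg (fun f : Module.End k V => f (Y v)) ih
    simp only [Module.End.mul_apply, aeval_X_sub_C_apply] at this ⊢
    rw [pow_succ, Module.End.mul_apply, Module.End.mul_apply, this, T.hy]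
    simp only [map_sub, map_smul]
    push_cast
    module

theorem mul_X_pow (T : IsSl2Rel X H Y) (m : ℕ) (v : V) :
    H ((X ^ m) v) = (X ^ m) (H v) + (2 * m : k) • (X ^ m) v := by
  have := congrArg (fun f : Module.End k V => f v) (T.symm.mul_Y_pow m)
  rw [Module.End.mul_apply, Module.End.mul_apply, aeval_X_sub_C_apply, map_sub, map_smul,
    LinearMap.neg_apply, LinearMap.neg_apply, map_neg] at this
  rw [← neg_inj, this]
  module

theorem aeval_Y_pow (T : IsSl2Rel X H Y) (p : k[X]) (m : ℕ) (v : V) :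
    aeval H p ((Y ^ m) v) = (Y ^ m) (aeval H (p.comp (Polynomial.X - C (2 * m : k))) v) := by
  have := congrArg (fun f : Module.End k V => f v) (aeval_mul_of_mul_eq (T.mul_Y_pow m) p)
  rwa [← aeval_comp] at this

theorem Y_X_pow (T : IsSl2Rel X H Y) (m : ℕ) (v : V) :
    Y ((X ^ (m + 1)) v) = (X ^ (m + 1)) (Y v) - (m + 1 : k) • (X ^ m) (H v + (m : k) • v) := by
  induction m generalizing v with
  | zero =>
    have e : Y (X v) = X (Y v) - H v := by rw [T.xy]; abel
    simp [e]
  | succ m ih =>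
    have e : Y (X v) = X (Y v) - H v := by rw [T.xy]; abel
    rw [pow_succ, Module.End.mul_apply, ih, e, T.hx, Module.End.mul_apply]
    have e2 : ∀ u, (X ^ m) (X u) = (X ^ (m + 1)) u := fun u => by
      rw [pow_succ, Module.End.mul_apply]
    simp only [map_sub, map_add, map_smul, e2]
    push_cast
    module

theorem H_mem_ker (T : IsSl2Rel X H Y) {v : V} (hv : v ∈ LinearMap.ker Y) :
    H v ∈ LinearMap.ker Y := by
  have := T.hy v
  rw [LinearMap.mem_ker] at hv ⊢
  rw [hv] at this
  simpa using this.symm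

theorem casimir_eqOn_ker {u : V} (hu : u ∈ LinearMap.ker Y) :
    casimir X H Y u = aeval H (Polynomial.X ^ 2 - C 2 * Polynomial.X : k[X]) u := by
  rw [LinearMap.mem_ker] at hu
  simp [casimir_apply, hu, pow_two, Module.algebraMap_end_apply]

theorem aeval_casimir_of_mem_ker (T : IsSl2Rel X H Y) (p : k[X]) {u : V} (hu : Y u = 0) :
    aeval (casimir X H Y) p u
      = aeval H (p.comp (Polynomial.X ^ 2 - C 2 * Polynomial.X)) u := by
  rw [aeval_comp]
  refine aeval_apply_eq_of_eqOn (W := LinearMap.ker Y) (fun u hu => casimir_eqOn_ker hu)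
    (fun u hu => ?_) p hu
  have h1 := T.H_mem_ker hu
  have h2 := T.H_mem_ker h1
  rw [LinearMap.mem_ker] at hu h1 h2 ⊢
  simp [h1, h2, pow_two, Module.algebraMap_end_apply]

/-- On `ker Y` the Casimir value `d ^ 2 - 1` leaves only the weights `1 - d` and `d + 1`; for a
natural number `d`, nilpotency of `X` later excludes the second. -/
theorem casimir_factor (d : k) :
    (Polynomial.X - C (d ^ 2 - 1)).comp (Polynomial.X ^ 2 - C 2 * Polynomial.X)
      = (Polynomial.X - C (1 - d)) * (Polynomial.X - C (d + 1)) := by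
  rw [sub_comp, X_comp, C_comp]
  simp only [map_sub, map_add, map_pow, map_one]
  have : (C 2 : k[X]) = 2 := rfl
  rw [this]
  ring

theorem aeval_casimir_comm_Y (T : IsSl2Rel X H Y) (p : k[X]) (m : ℕ) (v : V) :
    aeval (casimir X H Y) p ((Y ^ m) v) = (Y ^ m) (aeval (casimir X H Y) p v) :=
  congrArg (fun f : Module.End k V => f v)
    (aeval_mul_of_mul_eq ((show Commute _ _ from T.commute_casimir_Y).pow_right m).eq p)

theorem aeval_casimir_comm_X (T : IsSl2Rel X H Y) (p : k[X]) (m : ℕ) (v : V) :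
    aeval (casimir X H Y) p ((X ^ m) v) = (X ^ m) (aeval (casimir X H Y) p v) :=
  congrArg (fun f : Module.End k V => f v)
    (aeval_mul_of_mul_eq ((show Commute _ _ from T.commute_casimir_X).pow_right m).eq p)

/-! ### Weights on `ker Y` and complete reducibility in characteristic zero. -/

variable [CharZero k]

/-- By `Y_X_pow`, `Y^(m+1) X^(m+1) v = -(m+1) Y^m X^m (H + m) v` for `v` in `ker Y`, and `(H + m) v`
is again in `ker Y`. The constant is `(-1)^m m!`. -/
theorem exists_Y_pow_X_pow (T : IsSl2Rel X H Y) (m : ℕ) :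
    ∃ c : k, c ≠ 0 ∧ ∀ v, Y v = 0 →
      (Y ^ m) ((X ^ m) v) = c • aeval H (rootPoly (fun j => -(j : k)) m) v := by
  induction m with
  | zero => exact ⟨1, one_ne_zero, fun v _ => by simp [rootPoly]⟩
  | succ m ih =>
    obtain ⟨c, hc, h⟩ := ih
    refine ⟨-(m + 1 : k) * c, mul_ne_zero (neg_ne_zero.2 (Nat.cast_add_one_ne_zero m)) hc,
      fun v hv => ?_⟩
    have hw : Y (H v + (m : k) • v) = 0 := by
      rw [map_add, map_smul, hv, smul_zero, add_zero]
      exact T.H_mem_ker hv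
    rw [pow_succ Y, Module.End.mul_apply, T.Y_X_pow, hv, map_zero, zero_sub, map_neg, map_smul,
      h _ hw, rootPoly_succ, map_mul, Module.End.mul_apply, aeval_X_sub_C_apply]
    rw [neg_smul, sub_neg_eq_add]
    module

/-- On the kernel of `Y` the operator `H` is diagonalizable with eigenvalues `0, -1, -2, …`. -/
theorem aeval_rootPoly_of_mem_ker (T : IsSl2Rel X H Y) {N : ℕ} (hX : X ^ N = 0) {v : V}
    (hv : Y v = 0) : aeval H (rootPoly (fun j => -(j : k)) N) v = 0 := by
  obtain ⟨c, hc, h⟩ := T.exists_Y_pow_X_pow N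
  have := h v hv
  rw [hX, LinearMap.zero_apply, map_zero] at this
  exact (smul_eq_zero.1 this.symm).resolve_left hc

theorem lowestWeight_eq_bot (T : IsSl2Rel X H Y) {N : ℕ} (hX : X ^ N = 0) {d : ℕ}
    (hd : d = 0 ∨ N < d) : lowestWeight H Y d = ⊥ := by
  rw [eq_bot_iff]
  intro v hv
  have h := T.aeval_rootPoly_of_mem_ker hX hv.1
  rw [aeval_apply_of_apply_eq_smul hv.2] at h
  refine (smul_eq_zero.1 h).resolve_left ?_
  rw [rootPoly, eval_prod]
  refine Finset.prod_ne_zero_iff.2 fun j hj => ?_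
  rw [Finset.mem_range] at hj
  simp only [eval_sub, eval_X, eval_C, ne_eq]
  intro h0
  have : (d : k) = ((j + 1 : ℕ) : k) := by push_cast; linear_combination -h0
  have := Nat.cast_injective this
  omega

/-- The scalar is a nonzero multiple of `∏_{j<m} (1 - d + j)`, whose factors cannot vanish as `j + 1
< d`. -/
theorem Y_pow_X_pow_of_mem_lowestWeight (T : IsSl2Rel X H Y) {d m : ℕ} (hm : m < d) :
    ∃ c : k, c ≠ 0 ∧ ∀ v ∈ lowestWeight H Y d, (Y ^ m) ((X ^ m) v) = c • v := by
  obtain ⟨c, hc, h⟩ := T.exists_Y_pow_X_pow m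
  refine ⟨c * (rootPoly (fun j => -(j : k)) m).eval (1 - d : k), mul_ne_zero hc ?_,
    fun v hv => ?_⟩
  · rw [rootPoly, eval_prod, Finset.prod_ne_zero_iff]
    intro j hj
    rw [Finset.mem_range] at hj
    simp only [eval_sub, eval_X, eval_C, ne_eq]
    intro h0
    have : (d : k) = ((j + 1 : ℕ) : k) := by push_cast; linear_combination -h0
    have := Nat.cast_injective this
    omega
  · rw [h v hv.1, aeval_apply_of_apply_eq_smul hv.2, smul_smul]

/-- A vector killed by `Y` in a generalized eigenspace of the Casimir operator is a lowest weight
vector. -/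
theorem mem_lowestWeight_of_casimir (T : IsSl2Rel X H Y) {N : ℕ} (hX : X ^ N = 0) {d M : ℕ}
    (hd : 1 ≤ d) {u : V} (hu : Y u = 0)
    (hc : aeval (casimir X H Y) ((Polynomial.X - C ((d : k) ^ 2 - 1)) ^ M) u = 0) :
    u ∈ lowestWeight H Y d := by
  refine ⟨hu, ?_⟩
  rw [← sub_eq_zero, ← aeval_X_sub_C_apply]
  rw [T.aeval_casimir_of_mem_ker _ hu, pow_comp, casimir_factor] at hc
  -- The annihilator of `ker Y` with its possible root `1 - d` removed. It kills `(H - (1 - d)) u`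
  -- and is coprime to the other annihilator, whose roots are `1 - d` and `d + 1`.
  set p : k[X] := ∏ j ∈ (Finset.range N).erase (d - 1), (Polynomial.X - C (-(j : k))) with hp
  refine eq_zero_of_isCoprime_aeval (f := H) (p := p)
    (q := ((Polynomial.X - C (1 - (d : k))) * (Polynomial.X - C ((d : k) + 1))) ^ M) ?_ ?_ ?_
  · refine IsCoprime.pow_right (IsCoprime.mul_right ?_ ?_) <;>
      refine IsCoprime.prod_left fun j hj => isCoprime_X_sub_C fun h => ?_
    · have h' : (d : k) = ((j + 1 : ℕ) : k) := by push_cast; linear_combination h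
      have := Nat.cast_injective h'
      simp [this] at hj
    · have h' : ((d + 1 + j : ℕ) : k) = ((0 : ℕ) : k) := by push_cast; linear_combination -h
      have := Nat.cast_injective h'
      omega
  · rw [← Module.End.mul_apply, ← map_mul]
    have hdvd : rootPoly (fun j => -(j : k)) N ∣ p * (Polynomial.X - C (1 - (d : k))) := by
      by_cases h : d - 1 ∈ Finset.range N
      · have e : (1 - (d : k)) = -((d - 1 : ℕ) : k) := by
          rw [Nat.cast_sub hd]; simp
        rw [e, hp, Finset.prod_erase_mul _ _ h]
        exact dvd_rfl
      · rw [hp, Finset.erase_eq_of_notMem h]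
        exact dvd_mul_right _ _
    obtain ⟨q, hq⟩ := hdvd
    rw [hq, mul_comm, map_mul, Module.End.mul_apply, T.aeval_rootPoly_of_mem_ker hX hu, map_zero]
  · rw [← Module.End.mul_apply, ← map_mul, mul_comm, map_mul, Module.End.mul_apply, hc, map_zero]

/-- A product `Q` of distinct linear factors in the Casimir operator kills `ker Y`. As the Casimir
operator commutes with `Y`, `Q^m` kills `ker Y^m`; take `m = N`. -/
theorem iSup_casimir_eq_top (T : IsSl2Rel X H Y) {N : ℕ} (hX : X ^ N = 0) (hY : Y ^ N = 0) :
    ⨆ j ∈ Finset.range N, LinearMap.ker (aeval (casimir X H Y)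
      ((Polynomial.X - C (((j + 1 : ℕ) : k) ^ 2 - 1)) ^ N)) = ⊤ := by
  set Q : k[X] := ∏ j ∈ Finset.range N, (Polynomial.X - C (((j + 1 : ℕ) : k) ^ 2 - 1)) with hQ
  have hker : ∀ u, Y u = 0 → aeval (casimir X H Y) Q u = 0 := by
    intro u hu
    rw [T.aeval_casimir_of_mem_ker _ hu, hQ, Polynomial.prod_comp]
    simp only [casimir_factor]
    rw [Finset.prod_mul_distrib, mul_comm, map_mul, Module.End.mul_apply]
    have : ∀ j : ℕ, (1 - ((j + 1 : ℕ) : k)) = -(j : k) := fun j => by push_cast; ring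
    simp only [this]
    have := T.aeval_rootPoly_of_mem_ker hX hu
    rw [rootPoly] at this
    rw [this, map_zero]
  have hpow : ∀ m v, (Y ^ m) v = 0 → aeval (casimir X H Y) (Q ^ m) v = 0 := by
    intro m
    induction m with
    | zero => intro v hv; simpa using hv
    | succ m ih =>
      intro v hv
      rw [pow_succ, map_mul, Module.End.mul_apply]
      apply ih
      rw [← T.aeval_casimir_comm_Y]
      apply hker
      rwa [← Module.End.mul_apply, ← pow_succ']
  rw [eq_top_iff]
  refine le_trans ?_ (mem_iSup_ker_of_aeval_prod _ _ fun i _ j _ hij =>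
    IsCoprime.pow (isCoprime_X_sub_C fun h => hij ?_))
  · rw [Finset.prod_pow]
    intro v _
    exact hpow N v (by rw [hY, LinearMap.zero_apply])
  · have h' : (((i + 1) ^ 2 : ℕ) : k) = (((j + 1) ^ 2 : ℕ) : k) := by
      push_cast at h ⊢
      linear_combination h
    have := Nat.pow_left_injective two_ne_zero (Nat.cast_injective h')
    simpa using this

/-- On a generalized eigenspace of the Casimir operator the weights are at least `1 - d`. -/
theorem aeval_rootPoly_of_casimir (T : IsSl2Rel X H Y) {N : ℕ} (hX : X ^ N = 0) {d M : ℕ}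
    (hd : 1 ≤ d) (m : ℕ) {v : V}
    (hc : aeval (casimir X H Y) ((Polynomial.X - C ((d : k) ^ 2 - 1)) ^ M) v = 0)
    (hv : (Y ^ m) v = 0) :
    aeval H (rootPoly (fun j => (1 - d : k) + 2 * j) m) v = 0 := by
  induction m generalizing v with
  | zero => simpa [rootPoly] using hv
  | succ m ih =>
    rw [rootPoly_succ, map_mul, Module.End.mul_apply]
    apply ih
    · have hcomm := congrArg (fun f : Module.End k V => f v) (aeval_mul_of_mul_eq
        (show Commute _ _ from T.commute_casimir_H).eq
          ((Polynomial.X - C ((d : k) ^ 2 - 1)) ^ M))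
      simp only [Module.End.mul_apply] at hcomm
      rw [aeval_X_sub_C_apply, map_sub, map_smul, hc, hcomm, hc, map_zero, smul_zero, sub_zero]
    -- Since `Y^m v` has weight `1 - d`, moving `H` past `Y^m` shows that `Y^m` kills `(H - (1 - d +
    -- 2m)) v`.
    · have hu : (Y ^ m) v ∈ lowestWeight H Y d := by
        refine T.mem_lowestWeight_of_casimir hX (M := M) hd ?_ ?_
        · rwa [← Module.End.mul_apply, ← pow_succ']
        · rw [T.aeval_casimir_comm_Y, hc, map_zero]
      have h2 := hu.2
      have h3 := congrArg (fun f : Module.End k V => f v) (T.mul_Y_pow m)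
      simp only [Module.End.mul_apply, aeval_X_sub_C_apply] at h3 ⊢
      rw [h3] at h2
      simp only [map_sub, map_smul] at h2 ⊢
      rw [add_smul, ← h2]
      module

/-- By symmetry the weights of `v` are at most `d - 1`, so those of `Y^d v` are at most `-1 - d`;
yet they are also at least `1 - d`. -/
theorem Y_pow_eq_zero_of_casimir (T : IsSl2Rel X H Y) {N : ℕ} (hX : X ^ N = 0) (hY : Y ^ N = 0)
    {d M : ℕ} (hd : 1 ≤ d) {v : V}
    (hc : aeval (casimir X H Y) ((Polynomial.X - C ((d : k) ^ 2 - 1)) ^ M) v = 0) :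
    (Y ^ d) v = 0 := by
  have hc' : aeval (casimir X H Y) ((Polynomial.X - C ((d : k) ^ 2 - 1)) ^ M) ((Y ^ d) v) = 0 := by
    rw [T.aeval_casimir_comm_Y, hc, map_zero]
  have h1 := T.aeval_rootPoly_of_casimir hX hd N hc' (by rw [hY, LinearMap.zero_apply])
  have h2 := T.symm.aeval_rootPoly_of_casimir hY (M := M) (v := v) hd N
    (by rw [T.casimir_symm]; exact hc) (by rw [hX, LinearMap.zero_apply])
  have h3 : aeval H (rootPoly (fun j => (d - 1 : k) - 2 * j) N) v = 0 := by
    -- The symmetric triple bounds the weights of `-H`; substituting `-X` for the variable negates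
    -- the roots.
    have e : (rootPoly (fun j : ℕ => (1 - d : k) + 2 * j) N).comp (-Polynomial.X)
        = (-1) ^ N * rootPoly (fun j => (d - 1 : k) - 2 * j) N := by
      simp only [rootPoly, Polynomial.prod_comp]
      rw [← Finset.card_range N, ← Finset.prod_const, Finset.card_range,
        ← Finset.prod_mul_distrib]
      refine Finset.prod_congr rfl fun j _ => ?_
      rw [sub_comp, X_comp, C_comp]
      simp only [map_add, map_sub]
      ring
    have e2 : -H = aeval H (-Polynomial.X : k[X]) := by simp
    rw [e2, ← aeval_comp, e, map_mul, Module.End.mul_apply] at h2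
    have e3 := congrArg (aeval H ((-1) ^ N : k[X])) h2
    rw [← Module.End.mul_apply, ← map_mul, ← mul_pow] at e3
    simpa using e3
  have h4 : aeval H (rootPoly (fun j => (-1 - d : k) - 2 * j) N) ((Y ^ d) v) = 0 := by
    rw [T.aeval_Y_pow, rootPoly_comp]
    have : (fun j : ℕ => (-1 - d : k) - 2 * j + 2 * d) = fun j : ℕ => (d - 1 : k) - 2 * j := by
      ext j; ring
    rw [this, h3, map_zero]
  refine eq_zero_of_isCoprime_aeval (isCoprime_rootPoly (fun i j h => ?_) N N) h1 h4
  have h' : ((2 + 2 * i + 2 * j : ℕ) : k) = ((0 : ℕ) : k) := by push_cast; linear_combination h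
  have := Nat.cast_injective h'
  omega

theorem X_pow_eq_zero_of_mem_lowestWeight (T : IsSl2Rel X H Y) {N : ℕ} (hX : X ^ N = 0)
    (hY : Y ^ N = 0) {d : ℕ} (hd : 1 ≤ d) {v : V} (hv : v ∈ lowestWeight H Y d) :
    (X ^ d) v = 0 := by
  refine T.symm.Y_pow_eq_zero_of_casimir hY hX hd (M := 1) ?_
  rw [T.casimir_symm, pow_one, aeval_X_sub_C_apply, casimir_of_mem_lowestWeight hv, sub_self]

/-- Complete reducibility: a module on which `X` and `Y` are nilpotent is spanned by the strings
through its lowest weight vectors. -/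
theorem span_strings_eq_top (T : IsSl2Rel X H Y) {N : ℕ} (hX : X ^ N = 0) (hY : Y ^ N = 0) :
    Submodule.span k {v | ∃ d i w, 1 ≤ d ∧ d ≤ N ∧ i < d ∧ w ∈ lowestWeight H Y d ∧
      v = (X ^ i) w} = ⊤ := by
  rw [eq_top_iff, ← T.iSup_casimir_eq_top hX hY]
  refine iSup₂_le fun j hj => ?_
  rw [Finset.mem_range] at hj
  have key : ∀ m v, aeval (casimir X H Y)
      ((Polynomial.X - C (((j + 1 : ℕ) : k) ^ 2 - 1)) ^ N) v = 0 → (Y ^ m) v = 0 →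
      v ∈ Submodule.span k {v | ∃ d i w, 1 ≤ d ∧ d ≤ N ∧ i < d ∧ w ∈ lowestWeight H Y d ∧
        v = (X ^ i) w} := by
    intro m
    induction m with
    | zero =>
      intro v _ hv
      have : v = 0 := by simpa using hv
      rw [this]
      exact Submodule.zero_mem _
    | succ m ih =>
      intro v hc hv
      have hu : (Y ^ m) v ∈ lowestWeight H Y (j + 1) := by
        refine T.mem_lowestWeight_of_casimir hX (M := N) (by omega) ?_ ?_
        · rwa [← Module.End.mul_apply, ← pow_succ']
        · rw [T.aeval_casimir_comm_Y, hc, map_zero]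
      -- Below the string length, subtracting a multiple of `X^m Y^m v` produces a vector killed by
      -- `Y^m`; from that length on, `Y^m v` already vanishes.
      by_cases hm : m < j + 1
      · obtain ⟨c, hc0, h⟩ := T.Y_pow_X_pow_of_mem_lowestWeight hm
        have h1 : v - c⁻¹ • (X ^ m) ((Y ^ m) v) ∈ _ := ih _ ?_ ?_
        · rw [← sub_add_cancel v (c⁻¹ • (X ^ m) ((Y ^ m) v))]
          refine Submodule.add_mem _ h1 (Submodule.smul_mem _ _ (Submodule.subset_span ?_))
          exact ⟨j + 1, m, _, by omega, hj, hm, hu, rfl⟩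
        · rw [map_sub, map_smul, T.aeval_casimir_comm_X, T.aeval_casimir_comm_Y, hc]
          simp
        · rw [map_sub, map_smul, h _ hu, smul_smul, inv_mul_cancel₀ hc0, one_smul, sub_self]
      · apply ih v hc
        obtain ⟨l, rfl⟩ := Nat.exists_eq_add_of_le' (not_lt.1 hm)
        rw [pow_add, Module.End.mul_apply,
          T.Y_pow_eq_zero_of_casimir hX hY (by omega) hc, map_zero]
  exact fun v hv => key N v hv (by rw [hY, LinearMap.zero_apply])

/-! ### Independence and invariance of strings. -/

/-- The Casimir eigenvalues `d ^ 2 - 1` separate the lengths, then the weights `1 - d + 2i` separate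
positions within one length. -/
theorem X_pow_eq_zero_of_sum_eq_zero (T : IsSl2Rel X H Y) {ι : Type*} [Fintype ι] {δ : ι → ℕ}
    (hδ : Function.Injective δ) (w : ∀ d, Fin (δ d) → V)
    (hw : ∀ d i, w d i ∈ lowestWeight H Y (δ d))
    (h : ∑ d : ι, ∑ i : Fin (δ d), (X ^ (i : ℕ)) (w d i) = 0) (d : ι) (i : Fin (δ d)) :
    (X ^ (i : ℕ)) (w d i) = 0 := by
  have h1 : ∀ d ∈ (Finset.univ : Finset ι), ∑ i : Fin (δ d), (X ^ (i : ℕ)) (w d i) = 0 := by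
    have hind := ((casimir X H Y).eigenspaces_iSupIndep).comp
      (f := fun d : ι => (δ d : k) ^ 2 - 1) (fun a b hab => hδ (by
        have h' : ((δ a ^ 2 : ℕ) : k) = ((δ b ^ 2 : ℕ) : k) := by
          push_cast
          simpa using hab
        exact Nat.pow_left_injective two_ne_zero (Nat.cast_injective h')))
    refine (iSupIndep_iff_finsetSum_eq_zero_imp_eq_zero _).1 hind Finset.univ _ (fun d _ => ?_) h
    refine Submodule.sum_mem _ fun i _ => ?_
    rw [Function.comp_apply, Module.End.mem_eigenspace_iff]
    have := congrArg (fun f : Module.End k V => f (w d i))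
      ((show Commute _ _ from T.commute_casimir_X).pow_right i).eq
    simp only [Module.End.mul_apply] at this
    rw [this, casimir_of_mem_lowestWeight (hw d i), map_smul]
  have hind := (H.eigenspaces_iSupIndep).comp
    (f := fun i : Fin (δ d) => (1 - δ d : k) + 2 * (i : ℕ)) (fun a b hab => by
      have hab : (1 - δ d : k) + 2 * (a : ℕ) = (1 - δ d : k) + 2 * (b : ℕ) := hab
      have h' : ((2 * a : ℕ) : k) = ((2 * b : ℕ) : k) := by
        push_cast
        linear_combination hab
      have := Nat.cast_injective h'
      omega)
  refine (iSupIndep_iff_finsetSum_eq_zero_imp_eq_zero _).1 hind _ _ (fun i _ => ?_)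
    (h1 d (Finset.mem_univ _)) i (Finset.mem_univ _)
  rw [Function.comp_apply, Module.End.mem_eigenspace_iff, T.mul_X_pow, (hw d i).2, map_smul,
    add_smul]

theorem eq_zero_of_X_pow_eq_zero (T : IsSl2Rel X H Y) {d m : ℕ} (hm : m < d) {v : V}
    (hv : v ∈ lowestWeight H Y d) (h : (X ^ m) v = 0) : v = 0 := by
  obtain ⟨c, hc, h'⟩ := T.Y_pow_X_pow_of_mem_lowestWeight hm
  have := h' v hv
  rw [h, map_zero] at this
  exact (smul_eq_zero.1 this.symm).resolve_left hc

/-- The span of the `X`-string of length `d` through `w`. -/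
def string (X : Module.End k V) (d : ℕ) (w : V) : Submodule k V :=
  Submodule.span k (Set.range fun i : Fin d => (X ^ (i : ℕ)) w)

omit [CharZero k] in
theorem X_pow_mem_string {d i : ℕ} (hi : i < d) (w : V) : (X ^ i) w ∈ string X d w :=
  Submodule.subset_span ⟨⟨i, hi⟩, rfl⟩

omit [CharZero k] in
theorem string_le {A : Submodule k V} (hA : ∀ v ∈ A, X v ∈ A) (d : ℕ) {w : V} (hw : w ∈ A) :
    string X d w ≤ A := by
  refine Submodule.span_le.2 ?_
  rintro _ ⟨⟨i, _⟩, rfl⟩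
  change (X ^ i) w ∈ A
  induction i with
  | zero => simpa using hw
  | succ i ih =>
    rw [pow_succ', Module.End.mul_apply]
    exact hA _ (ih (by omega))

theorem string_invariant (T : IsSl2Rel X H Y) {N : ℕ} (hX : X ^ N = 0) (hY : Y ^ N = 0) {d : ℕ}
    (hd : 1 ≤ d) {w : V} (hw : w ∈ lowestWeight H Y d) {v : V} (hv : v ∈ string X d w) :
    X v ∈ string X d w ∧ H v ∈ string X d w ∧ Y v ∈ string X d w := by
  have key : ∀ f : Module.End k V, (∀ i < d, f ((X ^ i) w) ∈ string X d w) →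
      f v ∈ string X d w := by
    intro f hf
    have : string X d w ≤ (string X d w).comap f := by
      refine Submodule.span_le.2 ?_
      rintro _ ⟨⟨i, hi⟩, rfl⟩
      exact hf i hi
    exact this hv
  refine ⟨key X fun i hi => ?_, key H fun i hi => ?_, key Y fun i hi => ?_⟩
  · rw [← Module.End.mul_apply, ← pow_succ']
    rcases lt_or_eq_of_le (Nat.succ_le_of_lt hi) with h | h
    · exact X_pow_mem_string h w
    · rw [show i + 1 = d from h, T.X_pow_eq_zero_of_mem_lowestWeight hX hY hd hw]
      exact Submodule.zero_mem _
  · rw [T.mul_X_pow, hw.2, map_smul]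
    exact Submodule.add_mem _ (Submodule.smul_mem _ _ (X_pow_mem_string hi w))
      (Submodule.smul_mem _ _ (X_pow_mem_string hi w))
  · rcases i with _ | i
    · rw [pow_zero, Module.End.one_apply, hw.1]
      exact Submodule.zero_mem _
    · rw [T.Y_X_pow, hw.1, map_zero, zero_sub, hw.2, map_add, map_smul, map_smul]
      have := X_pow_mem_string (X := X) (show i < d by omega) w
      exact Submodule.neg_mem _ (Submodule.smul_mem _ _ (Submodule.add_mem _
        (Submodule.smul_mem _ _ this) (Submodule.smul_mem _ _ this)))

theorem finrank_string (T : IsSl2Rel X H Y) {d : ℕ} {w : V} (hw : w ∈ lowestWeight H Y d)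
    (hw0 : w ≠ 0) : Module.finrank k (string X d w) = d := by
  rw [string, finrank_span_eq_card, Fintype.card_fin]
  refine H.eigenvectors_linearIndependent' (fun i : Fin d => (1 - d : k) + 2 * (i : ℕ))
    (fun a b hab => ?_) _ fun i => ⟨?_, fun h => hw0 (T.eq_zero_of_X_pow_eq_zero i.2 hw h)⟩
  · have hab : (1 - d : k) + 2 * (a : ℕ) = (1 - d : k) + 2 * (b : ℕ) := hab
    have h' : ((2 * a : ℕ) : k) = ((2 * b : ℕ) : k) := by
      push_cast
      linear_combination hab
    have := Nat.cast_injective h'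
    omega
  · rw [Module.End.mem_eigenspace_iff, T.mul_X_pow, hw.2, map_smul, add_smul]

omit [CharZero k] in
theorem casimir_of_mem_string (T : IsSl2Rel X H Y) {d : ℕ} {w : V}
    (hw : w ∈ lowestWeight H Y d) {v : V} (hv : v ∈ string X d w) :
    casimir X H Y v = ((d : k) ^ 2 - 1) • v := by
  rw [← Module.End.mem_eigenspace_iff]
  refine string_le (X := X) (fun v hv => ?_) d ?_ hv
  · rw [Module.End.mem_eigenspace_iff] at hv ⊢
    have := congrArg (fun f : Module.End k V => f v) T.commute_casimir_X
    simp only [Module.End.mul_apply] at this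
    rw [this, hv, map_smul]
  · rw [Module.End.mem_eigenspace_iff]
    exact casimir_of_mem_lowestWeight hw

/-- A nonzero invariant subspace contains a lowest weight vector. -/
theorem exists_mem_lowestWeight (T : IsSl2Rel X H Y) {N : ℕ} (hX : X ^ N = 0) (hY : Y ^ N = 0)
    {A : Submodule k V} (hA : A ≠ ⊥) (hH : ∀ v ∈ A, H v ∈ A) (hYA : ∀ v ∈ A, Y v ∈ A) :
    ∃ d, 1 ≤ d ∧ ∃ w ∈ A, w ≠ 0 ∧ w ∈ lowestWeight H Y d := by
  have h1 : ∀ m, ∀ v ∈ A, v ≠ 0 → (Y ^ m) v = 0 → ∃ u ∈ A, u ≠ 0 ∧ Y u = 0 := by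
    intro m
    induction m with
    | zero => intro v _ hv h; exact absurd (by simpa using h) hv
    | succ m ih =>
      intro v hvA hv h
      by_cases hY0 : Y v = 0
      · exact ⟨v, hvA, hv, hY0⟩
      · exact ih (Y v) (hYA v hvA) hY0 (by rwa [← Module.End.mul_apply, ← pow_succ])
  -- Strip linear factors off the annihilator of `u`: either `u` is an eigenvector for the last
  -- root, or `(H + m) u` is a nonzero vector of `A ∩ ker Y` with one factor fewer.
  have h2 : ∀ m, ∀ u ∈ A, u ≠ 0 → Y u = 0 → aeval H (rootPoly (fun j => -(j : k)) m) u = 0 →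
      ∃ d, 1 ≤ d ∧ ∃ w ∈ A, w ≠ 0 ∧ w ∈ lowestWeight H Y d := by
    intro m
    induction m with
    | zero => intro u _ hu _ h; exact absurd (by simpa [rootPoly] using h) hu
    | succ m ih =>
      intro u huA hu hYu h
      rw [rootPoly_succ, map_mul, Module.End.mul_apply, aeval_X_sub_C_apply] at h
      by_cases h0 : H u - (-(m : k)) • u = 0
      · refine ⟨m + 1, by omega, u, huA, hu, hYu, ?_⟩
        rw [sub_eq_zero.1 h0]
        push_cast
        congr 1
        ring
      · refine ih _ (Submodule.sub_mem _ (hH u huA) (Submodule.smul_mem _ _ huA)) h0 ?_ h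
        have := T.H_mem_ker (v := u) hYu
        rw [LinearMap.mem_ker] at this
        rw [map_sub, map_smul, hYu, this, smul_zero, sub_zero]
  obtain ⟨v, hvA, hv⟩ := Submodule.exists_mem_ne_zero_of_ne_bot hA
  obtain ⟨u, huA, hu, hYu⟩ := h1 N v hvA hv (by rw [hY, LinearMap.zero_apply])
  exact h2 N u huA hu hYu (T.aeval_rootPoly_of_mem_ker hX hYu)

end IsSl2Rel

end Sl2

/-- Bracketing with `h` multiplies `x^k` by `kc`, so if no power vanished this operator would have
infinitely many eigenvalues on a finite-dimensional space. -/
theorem exists_pow_eq_zero_of_commutator {A : Type*} [Ring A] [Algebra ℝ A]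
    [FiniteDimensional ℝ A] {h x : A} {c : ℝ} (hc : c ≠ 0) (hx : h * x - x * h = c • x) :
    ∃ N, x ^ N = 0 := by
  by_contra! hne
  let f : Module.End ℝ A := LinearMap.mulLeft ℝ h - LinearMap.mulRight ℝ h
  have hf : ∀ k : ℕ, f (x ^ k) = (k * c : ℝ) • x ^ k := by
    intro k
    change h * x ^ k - x ^ k * h = _
    induction k with
    | zero => simp
    | succ k ih =>
      have : h * x ^ (k + 1) - x ^ (k + 1) * h
          = (h * x ^ k - x ^ k * h) * x + x ^ k * (h * x - x * h) := by
        rw [pow_succ]; noncomm_ring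
      rw [this, ih, hx, smul_mul_assoc, mul_smul_comm, ← pow_succ]
      push_cast
      module
  refine Set.infinite_of_injective_forall_mem (f := fun k : ℕ => (k * c : ℝ)) ?_ ?_
    f.finite_hasEigenvalue
  · intro a b hab
    exact Nat.cast_injective (mul_right_cancel₀ hc hab)
  · intro k
    exact Module.End.hasEigenvalue_of_hasEigenvector
      ⟨Module.End.mem_eigenspace_iff.2 (hf k), hne k⟩

variable {n : ℕ}

/-- The action of quaternionic matrices on column vectors by real linear maps. -/
def realAction : Matrix (Fin n) (Fin n) ℍ[ℝ] →+* Module.End ℝ (Fin n → ℍ[ℝ]) where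
  toFun A := Matrix.mulVecBilin ℝ ℝ A
  map_one' := LinearMap.ext fun v => Matrix.one_mulVec v
  map_mul' A B := LinearMap.ext fun v => (Matrix.mulVec_mulVec v A B).symm
  map_zero' := LinearMap.ext fun v => Matrix.zero_mulVec v
  map_add' A B := LinearMap.ext fun v => Matrix.add_mulVec A B v

@[simp]
theorem realAction_apply (A : Matrix (Fin n) (Fin n) ℍ[ℝ]) (v : Fin n → ℍ[ℝ]) :
    realAction A v = A *ᵥ v := rfl

/-! ### Irreducible submodules of `ℍⁿ` are strings. -/

section Triple

variable {X H Y : sl n}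

theorem isSl2Rel_realAction (hT : IsSl2Triple H X Y) :
    IsSl2Rel (realAction X.1) (realAction H.1) (realAction Y.1) := by
  have h1 : X.1 * Y.1 - Y.1 * X.1 = H.1 := congrArg Subtype.val hT.lie_e_f
  have h2 : H.1 * X.1 - X.1 * H.1 = 2 • X.1 := congrArg Subtype.val hT.lie_h_e_nsmul
  have h3 : H.1 * Y.1 - Y.1 * H.1 = -(2 • Y.1) := congrArg Subtype.val hT.lie_h_f_nsmul
  refine ⟨fun v => ?_, fun v => ?_, fun v => ?_⟩
  · rw [← Module.End.mul_apply, ← map_mul, sub_eq_iff_eq_add.1 h2]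
    simp [two_smul, add_comm]
  · rw [← Module.End.mul_apply, ← map_mul, sub_eq_iff_eq_add.1 h3]
    simp [two_smul]
    abel
  · rw [← Module.End.mul_apply, ← map_mul, sub_eq_iff_eq_add.1 h1]
    simp [add_comm]

theorem exists_pow_eq_zero (hT : IsSl2Triple H X Y) :
    ∃ N, ∀ M ≥ N, realAction X.1 ^ M = 0 ∧ realAction Y.1 ^ M = 0 := by
  have h2 : H.1 * X.1 - X.1 * H.1 = 2 • X.1 := congrArg Subtype.val hT.lie_h_e_nsmul
  have h3 : H.1 * Y.1 - Y.1 * H.1 = -(2 • Y.1) := congrArg Subtype.val hT.lie_h_f_nsmul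
  obtain ⟨a, ha⟩ := exists_pow_eq_zero_of_commutator (c := 2) two_ne_zero
    (h2.trans (by module))
  obtain ⟨b, hb⟩ := exists_pow_eq_zero_of_commutator (c := -2) (by norm_num)
    (h3.trans (by module))
  refine ⟨max a b, fun M hM => ⟨?_, ?_⟩⟩
  · rw [← map_pow, pow_eq_zero_of_le ((le_max_left a b).trans hM) ha, map_zero]
  · rw [← map_pow, pow_eq_zero_of_le ((le_max_right a b).trans hM) hb, map_zero]

/-- `A` contains a nonzero lowest weight vector, and the string through it is a nonzero invariant
subspace. -/
theorem IsIrreducibleSubmodule.eq_string (hT : IsSl2Triple H X Y)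
    {A : Submodule ℝ (Fin n → ℍ[ℝ])} (hA : IsIrreducibleSubmodule X H Y A) :
    ∃ w ∈ lowestWeight (realAction H.1) (realAction Y.1) (Module.finrank ℝ A),
      A = IsSl2Rel.string (realAction X.1) (Module.finrank ℝ A) w := by
  obtain ⟨N, hN⟩ := exists_pow_eq_zero hT
  obtain ⟨hX, hY⟩ := hN N le_rfl
  have T := isSl2Rel_realAction hT
  obtain ⟨d, hd, w, hwA, hw0, hw⟩ := T.exists_mem_lowestWeight hX hY hA.ne_bot
    (fun v hv => (hA.invariant v hv).2.1) (fun v hv => (hA.invariant v hv).2.2)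
  have hle : IsSl2Rel.string (realAction X.1) d w ≤ A :=
    IsSl2Rel.string_le (fun v hv => (hA.invariant v hv).1) d hwA
  have hfr := T.finrank_string hw hw0
  have heq := (hA.eq_bot_or_eq _ hle fun v hv => T.string_invariant hX hY hd hw hv).resolve_left
    fun h => by rw [h, finrank_bot] at hfr; omega
  rw [← heq, hfr]
  exact ⟨w, hw, rfl⟩

theorem casimir_of_mem_isotypic (hT : IsSl2Triple H X Y) (d : ℕ) {v : Fin n → ℍ[ℝ]}
    (hv : v ∈ isotypic X H Y d) :
    casimir (realAction X.1) (realAction H.1) (realAction Y.1) v = ((d : ℝ) ^ 2 - 1) • v := by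
  rw [← Module.End.mem_eigenspace_iff]
  refine (sSup_le ?_ : isotypic X H Y d ≤ _) hv
  rintro A ⟨hA, rfl⟩ v hv
  obtain ⟨w, hw, h⟩ := hA.eq_string hT
  rw [Module.End.mem_eigenspace_iff]
  refine (isSl2Rel_realAction hT).casimir_of_mem_string hw ?_
  rwa [← h]

/-- A nonzero invariant subspace contains a lowest weight vector, of the same type `d` by its
Casimir eigenvalue; the string through that vector already has full dimension. -/
theorem isIrreducibleSubmodule_string (hT : IsSl2Triple H X Y) {d : ℕ} (hd : 1 ≤ d)
    {w : Fin n → ℍ[ℝ]} (hw : w ∈ lowestWeight (realAction H.1) (realAction Y.1) d) (hw0 : w ≠ 0) :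
    IsIrreducibleSubmodule X H Y (IsSl2Rel.string (realAction X.1) d w) := by
  obtain ⟨N, hN⟩ := exists_pow_eq_zero hT
  obtain ⟨hX, hY⟩ := hN N le_rfl
  have T := isSl2Rel_realAction hT
  have hfr := T.finrank_string hw hw0
  refine ⟨fun h => ?_, fun v hv => T.string_invariant hX hY hd hw hv, fun B hB hBi => ?_⟩
  · rw [h, finrank_bot] at hfr
    omega
  · refine or_iff_not_imp_left.2 fun hB0 => ?_
    obtain ⟨e, he, u, huB, hu0, hu⟩ := T.exists_mem_lowestWeight hX hY hB0
      (fun v hv => (hBi v hv).2.1) (fun v hv => (hBi v hv).2.2)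
    have hc := T.casimir_of_mem_string hw (hB huB)
    rw [IsSl2Rel.casimir_of_mem_lowestWeight hu] at hc
    have hed : e = d := by
      have h := smul_left_injective ℝ hu0 hc
      have h' : ((e ^ 2 : ℕ) : ℝ) = ((d ^ 2 : ℕ) : ℝ) := by
        push_cast
        linear_combination h
      exact Nat.pow_left_injective two_ne_zero (Nat.cast_injective h')
    subst hed
    have hle : IsSl2Rel.string (realAction X.1) e u ≤ B :=
      IsSl2Rel.string_le (fun v hv => (hBi v hv).1) e huB
    refine le_antisymm hB ?_
    rw [← Submodule.eq_of_le_of_finrank_eq (hle.trans hB)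
      ((T.finrank_string hu hu0).trans hfr.symm)]
    exact hle

/-- Replaces the isotypic component by a weight equation. One direction uses its Casimir eigenvalue,
the other the irreducible string through `v`. -/
theorem mem_lowest_iff (hT : IsSl2Triple H X Y) {d : ℕ} (hd : 1 ≤ d) {v : Fin n → ℍ[ℝ]} :
    v ∈ lowest X H Y d ↔ v ∈ lowestWeight (realAction H.1) (realAction Y.1) d := by
  obtain ⟨N, hN⟩ := exists_pow_eq_zero hT
  obtain ⟨hX, hY⟩ := hN N le_rfl
  have T := isSl2Rel_realAction hT
  constructor
  · rintro ⟨hv, hvi⟩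
    refine T.mem_lowestWeight_of_casimir hX (M := 1) hd hv ?_
    rw [pow_one, aeval_X_sub_C_apply, casimir_of_mem_isotypic hT d hvi, sub_self]
  · intro hv
    refine ⟨hv.1, ?_⟩
    by_cases hv0 : v = 0
    · rw [hv0]
      exact Submodule.zero_mem _
    · have : IsSl2Rel.string (realAction X.1) d v ≤ isotypic X H Y d :=
        le_sSup ⟨isIrreducibleSubmodule_string hT hd hv hv0, T.finrank_string hv hv0⟩
      exact this (by simpa using IsSl2Rel.X_pow_mem_string (X := realAction X.1) hd v)

end Triple

/-! ### The string basis over `ℍ` and the ranks of powers of `X`. -/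

section Basis

variable {n : ℕ} {X H Y : sl n}

instance finite_opModule : Module.Finite (ℍ[ℝ])ᵐᵒᵖ (Fin n → ℍ[ℝ]) :=
  Module.Finite.of_restrictScalars_finite ℝ (ℍ[ℝ])ᵐᵒᵖ (Fin n → ℍ[ℝ])

/-- The action of quaternionic matrices on column vectors by right `ℍ`-linear maps. -/
def opAction : Matrix (Fin n) (Fin n) ℍ[ℝ] →+* Module.End (ℍ[ℝ])ᵐᵒᵖ (Fin n → ℍ[ℝ]) where
  toFun A := Matrix.mulVecBilin ℝ (ℍ[ℝ])ᵐᵒᵖ A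
  map_one' := LinearMap.ext fun v => Matrix.one_mulVec v
  map_mul' A B := LinearMap.ext fun v => (Matrix.mulVec_mulVec v A B).symm
  map_zero' := LinearMap.ext fun v => Matrix.zero_mulVec v
  map_add' A B := LinearMap.ext fun v => Matrix.add_mulVec A B v

@[simp]
theorem opAction_apply (A : Matrix (Fin n) (Fin n) ℍ[ℝ]) (v : Fin n → ℍ[ℝ]) :
    opAction A v = A *ᵥ v := rfl

theorem realAction_pow_apply (A : Matrix (Fin n) (Fin n) ℍ[ℝ]) (m : ℕ) (v : Fin n → ℍ[ℝ]) :
    (realAction A ^ m) v = (A ^ m) *ᵥ v := by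
  rw [← map_pow, realAction_apply]

theorem lowest_eq_bot (hT : IsSl2Triple H X Y) {N : ℕ} (hX : realAction X.1 ^ N = 0) {d : ℕ}
    (hd : N < d) : lowest X H Y d = ⊥ := by
  rw [eq_bot_iff]
  intro v hv
  rw [mem_lowest_iff hT (by omega),
    (isSl2Rel_realAction hT).lowestWeight_eq_bot hX (Or.inr hd)] at hv
  exact hv

variable {D : Finset ℕ} {t : ℕ → ℕ}

/-- The vectors `X ^ k v`, for `v` in given bases of the spaces of lowest weight vectors. -/
def stringVec (β : ∀ d : D, Module.Basis (Fin (t d)) (ℍ[ℝ])ᵐᵒᵖ (lowest X H Y d))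
    (j : Σ d : D, Fin (t d) × Fin d) : Fin n → ℍ[ℝ] :=
  (X.1 ^ (j.2.2 : ℕ)) *ᵥ (β j.1 j.2.1 : Fin n → ℍ[ℝ])

variable (β : ∀ d : D, Module.Basis (Fin (t d)) (ℍ[ℝ])ᵐᵒᵖ (lowest X H Y d))

theorem sum_smul_stringVec (g : (Σ d : D, Fin (t d) × Fin d) → (ℍ[ℝ])ᵐᵒᵖ) :
    ∑ j, g j • stringVec β j = ∑ d : D, ∑ k : Fin d, (realAction X.1 ^ (k : ℕ))
      (∑ i, g ⟨d, i, k⟩ • (β d i : Fin n → ℍ[ℝ])) := by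
  rw [Fintype.sum_sigma]
  refine Finset.sum_congr rfl fun d _ => ?_
  rw [Fintype.sum_prod_type_right]
  refine Finset.sum_congr rfl fun k _ => ?_
  rw [map_sum]
  refine Finset.sum_congr rfl fun i _ => ?_
  rw [realAction_pow_apply, Matrix.mulVec_smul]
  rfl

/-- Right quaternionic combinations of the `β d i` stay in `L(d-1)`, so independence of strings over
`ℝ` and injectivity of `X^k` on `L(d-1)` for `k < d` reduce everything to the bases `β d`. -/
theorem linearIndependent_stringVec (hT : IsSl2Triple H X Y) (hD : ∀ d ∈ D, 1 ≤ d) :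
    LinearIndependent (ℍ[ℝ])ᵐᵒᵖ (stringVec β) := by
  have T := isSl2Rel_realAction hT
  rw [Fintype.linearIndependent_iff]
  rintro g hg ⟨d, i, k⟩
  rw [sum_smul_stringVec] at hg
  have hmem : ∀ (d : D) (k : Fin d), ∑ i, g ⟨d, i, k⟩ • (β d i : Fin n → ℍ[ℝ]) ∈
      lowestWeight (realAction H.1) (realAction Y.1) (d : ℕ) := fun d k => by
    rw [← mem_lowest_iff hT (hD d d.2)]
    exact Submodule.sum_mem _ fun i _ => Submodule.smul_mem _ _ (β d i).2
  have h0 := T.X_pow_eq_zero_of_sum_eq_zero (δ := fun d : D => (d : ℕ)) Subtype.val_injective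
    (fun d k => ∑ i, g ⟨d, i, k⟩ • (β d i : Fin n → ℍ[ℝ])) hmem hg d k
  have h1 := T.eq_zero_of_X_pow_eq_zero k.2 (hmem d k) h0
  have h2 : ∑ i, g ⟨d, i, k⟩ • β d i = 0 := Subtype.ext (by simpa using h1)
  exact Fintype.linearIndependent_iff.1 (β d).linearIndependent _ h2 i

theorem span_stringVec (hT : IsSl2Triple H X Y)
    (hD' : ∀ d, 1 ≤ d → d ∉ D → lowest X H Y d = ⊥) :
    ⊤ ≤ Submodule.span (ℍ[ℝ])ᵐᵒᵖ (Set.range (stringVec β)) := by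
  have T := isSl2Rel_realAction hT
  obtain ⟨N, hN⟩ := exists_pow_eq_zero hT
  obtain ⟨hX, hY⟩ := hN N le_rfl
  have htop := T.span_strings_eq_top hX hY
  have hle : (⊤ : Submodule ℝ (Fin n → ℍ[ℝ])) ≤
      (Submodule.span (ℍ[ℝ])ᵐᵒᵖ (Set.range (stringVec β))).restrictScalars ℝ := by
    rw [← htop, Submodule.span_le]
    rintro _ ⟨d, i, w, hd, -, hi, hw, rfl⟩
    rw [← mem_lowest_iff hT hd] at hw
    change (realAction X.1 ^ i) w ∈ Submodule.span _ _
    rw [realAction_pow_apply]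
    by_cases hdD : d ∈ D
    · rw [← Subtype.coe_mk w hw, ← (β ⟨d, hdD⟩).sum_repr ⟨w, hw⟩, AddSubmonoidClass.coe_finsetSum,
        Matrix.mulVec_sum]
      refine Submodule.sum_mem _ fun l _ => ?_
      rw [Submodule.coe_smul, Matrix.mulVec_smul]
      exact Submodule.smul_mem _ _ (Submodule.subset_span ⟨⟨⟨d, hdD⟩, l, ⟨i, hi⟩⟩, rfl⟩)
    · rw [hD' d hd hdD, Submodule.mem_bot] at hw
      rw [hw, Matrix.mulVec_zero]
      exact Submodule.zero_mem _
  intro v _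
  exact hle (Submodule.mem_top (x := v))

/-- The basis of `ℍⁿ` formed by the strings through the lowest weight vectors. -/
def stringBasis (hT : IsSl2Triple H X Y) (hD : ∀ d ∈ D, 1 ≤ d)
    (hD' : ∀ d, 1 ≤ d → d ∉ D → lowest X H Y d = ⊥) :
    Module.Basis (Σ d : D, Fin (t d) × Fin d) (ℍ[ℝ])ᵐᵒᵖ (Fin n → ℍ[ℝ]) :=
  Module.Basis.mk (linearIndependent_stringVec β hT hD) (span_stringVec β hT hD')

-- `X^m` moves every string up by `m` places and kills its last `m` vectors, so `d - m` (truncated)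
-- survive in a string of length `d`.
include β in
theorem finrank_range_pow (hT : IsSl2Triple H X Y) (hD : ∀ d ∈ D, 1 ≤ d)
    (hD' : ∀ d, 1 ≤ d → d ∉ D → lowest X H Y d = ⊥) (m : ℕ) :
    Module.finrank (ℍ[ℝ])ᵐᵒᵖ (LinearMap.range (opAction (X.1 ^ m))) = ∑ d ∈ D, t d * (d - m) := by
  have T := isSl2Rel_realAction hT
  obtain ⟨N, hN⟩ := exists_pow_eq_zero hT
  obtain ⟨hX, hY⟩ := hN N le_rfl
  let f : (Σ d : D, Fin (t d) × Fin (d - m)) → (Σ d : D, Fin (t d) × Fin d) :=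
    fun j => ⟨j.1, j.2.1, ⟨m + j.2.2, by omega⟩⟩
  have hf : Function.Injective f := by
    rintro ⟨d, i, k⟩ ⟨d', i', k'⟩ h
    simp only [f, Sigma.mk.injEq] at h
    obtain ⟨rfl, h⟩ := h
    simp only [heq_eq_eq, Prod.mk.injEq, Fin.mk.injEq] at h
    obtain ⟨rfl, h⟩ := h
    have : k = k' := Fin.ext (by omega)
    rw [this]
  have hli := (linearIndependent_stringVec β hT hD).comp f hf
  have hrange : LinearMap.range (opAction (X.1 ^ m))
      = Submodule.span (ℍ[ℝ])ᵐᵒᵖ (Set.range (stringVec β ∘ f)) := by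
    rw [LinearMap.range_eq_map, ← top_le_iff.1 (span_stringVec β hT hD'), Submodule.map_span]
    apply le_antisymm
    · refine Submodule.span_le.2 ?_
      rintro _ ⟨_, ⟨⟨d, i, k⟩, rfl⟩, rfl⟩
      rw [opAction_apply, stringVec, Matrix.mulVec_mulVec, ← pow_add]
      by_cases h : m + k < d
      · exact Submodule.subset_span ⟨⟨d, i, ⟨k, by omega⟩⟩, rfl⟩
      · obtain ⟨l, hl⟩ := Nat.exists_eq_add_of_le' (not_lt.1 h)
        have h0 := T.X_pow_eq_zero_of_mem_lowestWeight hX hY (hD d d.2)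
          ((mem_lowest_iff hT (hD d d.2)).1 (β d i).2)
        rw [realAction_pow_apply] at h0
        rw [hl, pow_add, ← Matrix.mulVec_mulVec, h0, Matrix.mulVec_zero]
        exact Submodule.zero_mem _
    · refine Submodule.span_le.2 ?_
      rintro _ ⟨⟨d, i, k⟩, rfl⟩
      refine Submodule.subset_span ⟨_, ⟨⟨d, i, ⟨k, by omega⟩⟩, rfl⟩, ?_⟩
      rw [opAction_apply, stringVec, Matrix.mulVec_mulVec, ← pow_add]
      rfl
  rw [hrange, finrank_span_eq_card hli, Fintype.card_sigma, ← Finset.sum_coe_sort D]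
  simp

end Basis

/-! ### Multiplicities as invariants of the orbit. -/

section Multiplicity

variable {n : ℕ}

/-- The second difference in `m` of the truncated `d - m` is the indicator of one value of `d`. -/
theorem eq_of_forall_sum_tsub_eq {D : Finset ℕ} {t s : ℕ → ℕ}
    (h : ∀ m, ∑ d ∈ D, t d * (d - m) = ∑ d ∈ D, s d * (d - m)) {d : ℕ} (hd : d ∈ D)
    (hd0 : 1 ≤ d) : t d = s d := by
  obtain ⟨e, rfl⟩ := Nat.exists_eq_add_of_le' hd0
  have key : ∀ u : ℕ → ℕ, ∑ d ∈ D, u d * (d - e) + ∑ d ∈ D, u d * (d - (e + 2))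
      = 2 * ∑ d ∈ D, u d * (d - (e + 1)) + u (e + 1) := by
    intro u
    have : u (e + 1) = ∑ d ∈ D, u d * (if d = e + 1 then 1 else 0) := by simp [hd]
    rw [this, Finset.mul_sum, ← Finset.sum_add_distrib, ← Finset.sum_add_distrib]
    refine Finset.sum_congr rfl fun d _ => ?_
    have : (d - e) + (d - (e + 2)) = 2 * (d - (e + 1)) + if d = e + 1 then 1 else 0 := by
      split_ifs <;> omega
    rw [← mul_add, this]
    ring
  have h1 := key t
  have h2 := key s
  rw [h, h, h] at h1
  omega

/-- The multiplicities depend only on the conjugacy class of the nilpositive element. -/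
theorem finrank_lowest_eq_of_conj {X H Y X' H' Y' : sl n} (hT : IsSl2Triple H X Y)
    (hT' : IsSl2Triple H' X' Y') (g : SL n) (hg : Ad g X = X') {d : ℕ} (hd : 1 ≤ d) :
    Module.finrank (ℍ[ℝ])ᵐᵒᵖ (lowest X' H' Y' d) = Module.finrank (ℍ[ℝ])ᵐᵒᵖ (lowest X H Y d) := by
  obtain ⟨N, hN⟩ := exists_pow_eq_zero hT
  obtain ⟨N', hN'⟩ := exists_pow_eq_zero hT'
  -- Large enough that `Finset.Icc 1 M` contains the given `d` and every string length occurring for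
  -- either triple.
  set M := max d (max N N')
  have hX : realAction X.1 ^ M = 0 := (hN M (by simp [M])).1
  have hX' : realAction X'.1 ^ M = 0 := (hN' M (by simp [M])).1
  have hD : ∀ e ∈ Finset.Icc 1 M, 1 ≤ e := fun e he => (Finset.mem_Icc.1 he).1
  refine eq_of_forall_sum_tsub_eq (D := Finset.Icc 1 M)
    (t := fun d => Module.finrank (ℍ[ℝ])ᵐᵒᵖ (lowest X' H' Y' d))
    (s := fun d => Module.finrank (ℍ[ℝ])ᵐᵒᵖ (lowest X H Y d)) (fun m => ?_)
    (Finset.mem_Icc.2 ⟨hd, le_max_left _ _⟩) hd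
  rw [← finrank_range_pow (fun d => Module.finBasis _ _) hT' hD
    fun e he he' => lowest_eq_bot hT' hX' (by simpa [he] using he'),
    ← finrank_range_pow (fun d => Module.finBasis _ _) hT hD
    fun e he he' => lowest_eq_bot hT hX (by simpa [he] using he')]
  set G : Matrix.GeneralLinearGroup (Fin n) ℍ[ℝ] := g.1
  have hGX : ((G : Matrix (Fin n) (Fin n) ℍ[ℝ]) * X.1 * (G⁻¹).1) = X'.1 :=
    congrArg Subtype.val hg
  have hpow : X'.1 ^ m = G.1 * X.1 ^ m * (G⁻¹).1 := by
    rw [← hGX]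
    exact Units.conj_pow G X.1 m
  let e : (Fin n → ℍ[ℝ]) ≃ₗ[(ℍ[ℝ])ᵐᵒᵖ] (Fin n → ℍ[ℝ]) :=
    LinearEquiv.ofLinearMap (opAction G.1) (opAction (G⁻¹).1)
      (by rw [← Module.End.mul_eq_comp, ← map_mul, Units.mul_inv, map_one]; rfl)
      (by rw [← Module.End.mul_eq_comp, ← map_mul, Units.inv_mul, map_one]; rfl)
  have hr : LinearMap.range (opAction (X'.1 ^ m))
      = (LinearMap.range (opAction (X.1 ^ m))).map e.toLinearMap := by
    have hs : LinearMap.range (opAction (G⁻¹).1) = ⊤ := LinearEquiv.range e.symm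
    rw [hpow, map_mul, map_mul, Module.End.mul_eq_comp, LinearMap.range_comp_of_range_eq_top _ hs,
      Module.End.mul_eq_comp, LinearMap.range_comp]
    rfl
  rw [hr]
  exact LinearEquiv.finrank_map_eq e _

end Multiplicity

/-! ### Change of basis in a right module. -/

section BasisMatrix

variable {R : Type*} [Ring R] {ι κ : Type*}

/-- The matrix whose columns are the vectors of a basis of the right module `R ^ ι`. -/
def basisMatrix (b : Module.Basis κ Rᵐᵒᵖ (ι → R)) : Matrix ι κ R := Matrix.of fun r j => b j r

/-- The matrix of coordinates of the standard basis vectors with respect to a basis. -/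
def coordMatrix [DecidableEq ι] (b : Module.Basis κ Rᵐᵒᵖ (ι → R)) : Matrix κ ι R :=
  Matrix.of fun j r => (b.repr (Pi.single r 1) j).unop

theorem basisMatrix_mul_coordMatrix [DecidableEq ι] [Fintype κ]
    (b : Module.Basis κ Rᵐᵒᵖ (ι → R)) :
    basisMatrix b * coordMatrix b = 1 := by
  ext r s
  have h := congrFun (b.sum_repr (Pi.single s 1)) r
  rw [Finset.sum_apply] at h
  rw [Matrix.mul_apply, Matrix.one_apply, ← Pi.single_apply, ← h]
  rfl

theorem coordMatrix_mul_basisMatrix [Fintype ι] [DecidableEq ι] [DecidableEq κ]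
    (b : Module.Basis κ Rᵐᵒᵖ (ι → R)) :
    coordMatrix b * basisMatrix b = 1 := by
  ext j l
  have hb : b l = ∑ r, MulOpposite.op (b l r) • (Pi.single r 1 : ι → R) := by
    ext s
    simp [Finset.sum_apply, Pi.single_apply]
  have h : b.repr (b l) j = ∑ r, MulOpposite.op (b l r) * b.repr (Pi.single r 1) j := by
    conv_lhs => rw [hb]
    simp
  rw [b.repr_self] at h
  have h' := congrArg MulOpposite.unop h
  rw [Finset.unop_sum] at h'
  rw [Matrix.mul_apply]
  refine h'.symm.trans ?_
  rw [Finsupp.single_apply, Matrix.one_apply]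
  simp only [eq_comm (a := l)]
  split_ifs <;> simp

theorem mul_basisMatrix_apply [Fintype ι] (b : Module.Basis κ Rᵐᵒᵖ (ι → R)) (A : Matrix ι ι R)
    (r : ι) (j : κ) : (A * basisMatrix b) r j = (A *ᵥ b j) r := rfl

end BasisMatrix

/-! ### Matrices commuting with the triple, in the string basis. -/

section Commutant

variable {n : ℕ} {X H Y : sl n} {D : Finset ℕ} {t : ℕ → ℕ}

/-- The block diagonal matrix in which the block `a d` is repeated `d` times. -/
def repeatedBlocks (a : ∀ d : D, Matrix (Fin (t d)) (Fin (t d)) ℍ[ℝ]) :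
    Matrix (Σ d : D, Fin (t d) × Fin d) (Σ d : D, Fin (t d) × Fin d) ℍ[ℝ] :=
  Matrix.blockDiagonal' fun d => Matrix.blockDiagonal fun _ => a d

theorem sum_repeatedBlocks {R : Type*} [AddCommMonoid R]
    (a : ∀ d : D, Matrix (Fin (t d)) (Fin (t d)) ℍ[ℝ])
    (φ : (Σ d : D, Fin (t d) × Fin d) → ℍ[ℝ] → R) (hφ : ∀ j, φ j 0 = 0) (d : D) (i : Fin (t d))
    (k : Fin d) : ∑ j, φ j (repeatedBlocks a j ⟨d, i, k⟩) = ∑ l, φ ⟨d, l, k⟩ (a d l i) := by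
  rw [Fintype.sum_sigma, Finset.sum_eq_single d, Fintype.sum_prod_type]
  · refine Finset.sum_congr rfl fun l _ => ?_
    rw [Finset.sum_eq_single k]
    · simp [repeatedBlocks, Matrix.blockDiagonal'_apply, Matrix.blockDiagonal_apply]
    · intro k' _ hk
      simp [repeatedBlocks, Matrix.blockDiagonal'_apply, Matrix.blockDiagonal_apply, hk, hφ]
    · simp
  · intro d' _ hd
    refine Finset.sum_eq_zero fun x _ => ?_
    simp [repeatedBlocks, Matrix.blockDiagonal'_apply, hd, hφ]
  · simp

variable (β : ∀ d : D, Module.Basis (Fin (t d)) (ℍ[ℝ])ᵐᵒᵖ (lowest X H Y d))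

theorem mul_basisMatrix_eq_iff (hT : IsSl2Triple H X Y) (hD : ∀ d ∈ D, 1 ≤ d)
    (hD' : ∀ d, 1 ≤ d → d ∉ D → lowest X H Y d = ⊥) (A : Matrix (Fin n) (Fin n) ℍ[ℝ])
    (a : ∀ d : D, Matrix (Fin (t d)) (Fin (t d)) ℍ[ℝ]) :
    A * basisMatrix (stringBasis β hT hD hD')
        = basisMatrix (stringBasis β hT hD hD') * repeatedBlocks a ↔
      ∀ (d : D) (i : Fin (t d)) (k : Fin d), A *ᵥ stringVec β ⟨d, i, k⟩
        = ∑ l, MulOpposite.op (a d l i) • stringVec β ⟨d, l, k⟩ := by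
  have hb : ∀ j, stringBasis β hT hD hD' j = stringVec β j := fun j => Module.Basis.mk_apply _ _ _
  have key : ∀ (d : D) (i : Fin (t d)) (k : Fin d) (r : Fin n),
      (basisMatrix (stringBasis β hT hD hD') * repeatedBlocks a) r ⟨d, i, k⟩
        = (∑ l, MulOpposite.op (a d l i) • stringVec β ⟨d, l, k⟩) r := by
    intro d i k r
    rw [Matrix.mul_apply, sum_repeatedBlocks a
      (fun j q => basisMatrix (stringBasis β hT hD hD') r j * q) (fun j => mul_zero _),
      Finset.sum_apply]
    refine Finset.sum_congr rfl fun l _ => ?_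
    rw [basisMatrix, Matrix.of_apply, hb]
    rfl
  constructor
  · intro h d i k
    ext1 r
    rw [← key, ← h, mul_basisMatrix_apply, hb]
  · intro h
    ext1 r ⟨d, i, k⟩
    rw [key, ← h, mul_basisMatrix_apply, hb]

/-- Commuting with `H` and `Y` makes `A` preserve `L(d-1)`, where `a d` is its matrix; commuting
with `X` copies `a d` to all higher layers. -/
theorem exists_repeatedBlocks_of_commute (hT : IsSl2Triple H X Y) (hD : ∀ d ∈ D, 1 ≤ d)
    (hD' : ∀ d, 1 ≤ d → d ∉ D → lowest X H Y d = ⊥) {A : Matrix (Fin n) (Fin n) ℍ[ℝ]}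
    (hX : Commute A X.1) (hH : Commute A H.1) (hY : Commute A Y.1) :
    ∃ a : ∀ d : D, Matrix (Fin (t d)) (Fin (t d)) ℍ[ℝ],
      A * basisMatrix (stringBasis β hT hD hD')
          = basisMatrix (stringBasis β hT hD hD') * repeatedBlocks a := by
  have hmem : ∀ (d : D) (v : lowest X H Y d), A *ᵥ (v : Fin n → ℍ[ℝ]) ∈ lowest X H Y d := by
    intro d v
    have hv := v.2
    rw [mem_lowest_iff hT (hD d d.2), mem_lowestWeight, realAction_apply, realAction_apply] at hv ⊢
    constructor
    · rw [Matrix.mulVec_mulVec, ← hY.eq, ← Matrix.mulVec_mulVec, hv.1, Matrix.mulVec_zero]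
    · rw [Matrix.mulVec_mulVec, ← hH.eq, ← Matrix.mulVec_mulVec, hv.2, Matrix.mulVec_smul]
  refine ⟨fun d => Matrix.of fun l i => ((β d).repr ⟨_, hmem d (β d i)⟩ l).unop, ?_⟩
  rw [mul_basisMatrix_eq_iff]
  intro d i k
  rw [stringVec, Matrix.mulVec_mulVec, (hX.pow_right _).eq, ← Matrix.mulVec_mulVec]
  have h := congrArg Subtype.val ((β d).sum_repr ⟨_, hmem d (β d i)⟩)
  rw [AddSubmonoidClass.coe_finsetSum] at h
  change _ = A *ᵥ (β d i : Fin n → ℍ[ℝ]) at h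
  rw [← h, Matrix.mulVec_sum]
  refine Finset.sum_congr rfl fun l _ => ?_
  rw [Submodule.coe_smul, Matrix.mulVec_smul]
  rfl

theorem commute_of_mul_basisMatrix_eq (hT : IsSl2Triple H X Y) (hD : ∀ d ∈ D, 1 ≤ d)
    (hD' : ∀ d, 1 ≤ d → d ∉ D → lowest X H Y d = ⊥) {A : Matrix (Fin n) (Fin n) ℍ[ℝ]}
    {a : ∀ d : D, Matrix (Fin (t d)) (Fin (t d)) ℍ[ℝ]}
    (h : A * basisMatrix (stringBasis β hT hD hD')
        = basisMatrix (stringBasis β hT hD hD') * repeatedBlocks a) :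
    Commute A X.1 ∧ Commute A H.1 ∧ Commute A Y.1 := by
  have T := isSl2Rel_realAction hT
  obtain ⟨N, hN⟩ := exists_pow_eq_zero hT
  obtain ⟨hX, hY⟩ := hN N le_rfl
  have hb : ∀ j, stringBasis β hT hD hD' j = stringVec β j := fun j => Module.Basis.mk_apply _ _ _
  have hlow : ∀ (d : D) (i : Fin (t d)), (β d i : Fin n → ℍ[ℝ]) ∈
      lowestWeight (realAction H.1) (realAction Y.1) (d : ℕ) := fun d i =>
    (mem_lowest_iff hT (hD d d.2)).1 (β d i).2
  rw [mul_basisMatrix_eq_iff] at h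
  -- For `k ≥ d` both sides vanish, so the top of a string needs no separate treatment below.
  have h' : ∀ (d : D) (i : Fin (t d)) (k : ℕ), A *ᵥ (X.1 ^ k *ᵥ (β d i : Fin n → ℍ[ℝ]))
      = ∑ l, MulOpposite.op (a d l i) • (X.1 ^ k *ᵥ (β d l : Fin n → ℍ[ℝ])) := by
    intro d i k
    by_cases hk : k < d
    · exact h d i ⟨k, hk⟩
    · obtain ⟨l, rfl⟩ := Nat.exists_eq_add_of_le' (not_lt.1 hk)
      have h0 : ∀ i, X.1 ^ (l + (d : ℕ)) *ᵥ (β d i : Fin n → ℍ[ℝ]) = 0 := fun i => by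
        have := T.X_pow_eq_zero_of_mem_lowestWeight hX hY (hD d d.2) (hlow d i)
        rw [realAction_pow_apply] at this
        rw [pow_add, ← Matrix.mulVec_mulVec, this, Matrix.mulVec_zero]
      simp [h0]
  -- Each of `X`, `H`, `Y` carries a layer to a layer with a real factor independent of `i`; real
  -- factors commute with the quaternionic coefficients of `A`.
  have key : ∀ Z : Matrix (Fin n) (Fin n) ℍ[ℝ], (∀ (d : D) (k : ℕ), ∃ (c : ℝ) (m : ℕ),
      ∀ i, Z *ᵥ (X.1 ^ k *ᵥ (β d i : Fin n → ℍ[ℝ])) = c • (X.1 ^ m *ᵥ (β d i : Fin n → ℍ[ℝ]))) →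
      Commute A Z := by
    intro Z hZ
    have hcol : (A * Z) * basisMatrix (stringBasis β hT hD hD')
        = (Z * A) * basisMatrix (stringBasis β hT hD hD') := by
      ext1 r ⟨d, i, k⟩
      obtain ⟨c, m, hc⟩ := hZ d k
      rw [mul_basisMatrix_apply, mul_basisMatrix_apply, hb, stringVec]
      refine congrFun ?_ r
      rw [← Matrix.mulVec_mulVec, ← Matrix.mulVec_mulVec, hc, Matrix.mulVec_smul, h', h',
        Matrix.mulVec_sum, Finset.smul_sum]
      refine Finset.sum_congr rfl fun l _ => ?_
      rw [Matrix.mulVec_smul, hc, smul_comm]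
    have := congrArg (· * coordMatrix (stringBasis β hT hD hD')) hcol
    simp only [Matrix.mul_assoc, basisMatrix_mul_coordMatrix, Matrix.mul_one] at this
    exact this
  refine ⟨key _ fun d k => ⟨1, k + 1, fun i => ?_⟩, key _ fun d k =>
    ⟨(1 - d : ℝ) + 2 * k, k, fun i => ?_⟩, key _ fun d k => ?_⟩
  · rw [Matrix.mulVec_mulVec, ← pow_succ', one_smul]
  · have := T.mul_X_pow k (β d i : Fin n → ℍ[ℝ])
    rw [realAction_pow_apply, (hlow d i).2, map_smul, realAction_pow_apply, ← add_smul] at this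
    exact this
  · rcases k with _ | k
    · refine ⟨0, 0, fun i => ?_⟩
      rw [zero_smul, pow_zero, Matrix.one_mulVec]
      exact (hlow d i).1
    · refine ⟨-((k + 1 : ℝ) * ((1 - d : ℝ) + k)), k, fun i => ?_⟩
      have := T.Y_X_pow k (β d i : Fin n → ℍ[ℝ])
      rw [(hlow d i).1, map_zero, zero_sub, (hlow d i).2, ← add_smul, map_smul, smul_smul,
        realAction_pow_apply, realAction_pow_apply, ← neg_smul] at this
      exact this

end Commutant

/-! ### Reduced norms under conjugation and on block matrices. -/

section ReducedNorm

/-- The embedding of rectangular quaternionic matrices in complex matrices. -/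
def rectToComplex {ι κ : Type*} (A : Matrix ι κ ℍ[ℝ]) : Matrix (ι × Fin 2) (κ × Fin 2) ℂ :=
  Matrix.of fun x y => quatToComplex (A x.1 y.1) x.2 y.2

theorem rectToComplex_mul {ι κ μ : Type*} [Fintype κ] (A : Matrix ι κ ℍ[ℝ])
    (B : Matrix κ μ ℍ[ℝ]) : rectToComplex (A * B) = rectToComplex A * rectToComplex B := by
  ext x y
  simp only [rectToComplex, Matrix.of_apply, Matrix.mul_apply, map_sum, map_mul,
    Fintype.sum_prod_type, Matrix.sum_apply]

variable {ι κ : Type*} [Fintype ι] [DecidableEq ι] [Fintype κ] [DecidableEq κ]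

theorem nrd_eq_det_rectToComplex (A : Matrix ι ι ℍ[ℝ]) : nrd A = (rectToComplex A).det := rfl

theorem rectToComplex_one : rectToComplex (1 : Matrix ι ι ℍ[ℝ]) = 1 :=
  map_one (matToComplex (ι := ι))

theorem nrd_conj_of_mul_eq_one {P : Matrix ι κ ℍ[ℝ]} {Q : Matrix κ ι ℍ[ℝ]} (hPQ : P * Q = 1)
    (hQP : Q * P = 1) (B : Matrix κ κ ℍ[ℝ]) : nrd (P * B * Q) = nrd B := by
  rw [nrd_eq_det_rectToComplex, rectToComplex_mul, rectToComplex_mul,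
    Matrix.det_conj_of_mul_eq_one, nrd_eq_det_rectToComplex]
  · rw [← rectToComplex_mul, hPQ, rectToComplex_one]
  · rw [← rectToComplex_mul, hQP, rectToComplex_one]

/-- Any linear order on the index type makes the matrix block triangular; one is transported from
`Fin`. -/
theorem det_blockDiagonal'_eq_prod {α R : Type*} [CommRing R] [Fintype α] [dec : DecidableEq α]
    {m : α → Type*} [∀ a, Fintype (m a)] [∀ a, DecidableEq (m a)]
    (M : ∀ a, Matrix (m a) (m a) R) : (Matrix.blockDiagonal' M).det = ∏ a, (M a).det := by
  have key : ∀ ord : LinearOrder α, (Matrix.blockDiagonal' M).det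
      = ∏ a, ((Matrix.blockDiagonal' M).toSquareBlock Sigma.fst a).det := by
    intro ord
    obtain rfl : dec = ord.toDecidableEq := Subsingleton.elim _ _
    exact (Matrix.blockTriangular_blockDiagonal' M).det_fintype
  rw [key (LinearOrder.lift' (Fintype.equivFin α) (Fintype.equivFin α).injective)]
  refine Finset.prod_congr rfl fun a _ => ?_
  rw [← Matrix.det_submatrix_equiv_self (Equiv.sigmaSubtype a).symm]
  congr 1
  ext i j
  exact Matrix.blockDiagonal'_apply_eq M a i j

theorem nrd_blockDiagonal' {α : Type*} [Fintype α] [DecidableEq α]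
    {m : α → Type*} [∀ a, Fintype (m a)] [∀ a, DecidableEq (m a)]
    (M : ∀ a, Matrix (m a) (m a) ℍ[ℝ]) : nrd (Matrix.blockDiagonal' M) = ∏ a, nrd (M a) := by
  simp only [nrd_eq_det_rectToComplex]
  rw [← det_blockDiagonal'_eq_prod,
    ← Matrix.det_submatrix_equiv_self (Equiv.sigmaProdDistrib m (Fin 2))]
  congr 1
  ext ⟨⟨a, i⟩, x⟩ ⟨⟨b, j⟩, y⟩
  by_cases h : a = b
  · subst h
    simp [rectToComplex, Matrix.blockDiagonal'_apply, Equiv.sigmaProdDistrib]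
  · simp [rectToComplex, Matrix.blockDiagonal'_apply, Equiv.sigmaProdDistrib, h]

end ReducedNorm

/-! ### Embeddings of topological groups. -/

section Topological

/-- Both topologies are induced from `C`, so the bijection through the common range is continuous
both ways. -/
theorem nonempty_continuousMulEquiv_of_range_eq {A B C : Type*} [Group A] [Group B] [Group C]
    [TopologicalSpace A] [TopologicalSpace B] [TopologicalSpace C] {f : A →* C} {g : B →* C}
    (hf : Topology.IsEmbedding f) (hg : Topology.IsEmbedding g) (h : f.range = g.range) :
    Nonempty (A ≃ₜ* B) := by
  have hfg : ∀ a, ∃ b, g b = f a := fun a => by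
    rw [← MonoidHom.mem_range, ← h]
    exact ⟨a, rfl⟩
  have hgf : ∀ b, ∃ a, f a = g b := fun b => by
    rw [← MonoidHom.mem_range, h]
    exact ⟨b, rfl⟩
  choose φ hφ using hfg
  choose ψ hψ using hgf
  refine ⟨⟨⟨⟨φ, ψ, fun a => hf.injective ?_, fun b => hg.injective ?_⟩, fun a b =>
    hg.injective ?_⟩, ?_, ?_⟩⟩
  · rw [hψ, hφ]
  · rw [hφ, hψ]
  · simp only [map_mul, hφ]
  · exact hg.continuous_iff.2 (by simpa [Function.comp_def, hφ] using hf.continuous)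
  · exact hf.continuous_iff.2 (by simpa [Function.comp_def, hψ] using hg.continuous)

variable {R : Type*} [Ring R] {ι κ : Type*} [Fintype ι] [DecidableEq ι] [Fintype κ]
  [DecidableEq κ]

/-- Conjugation by a pair of mutually inverse rectangular matrices. -/
def conjHom {P : Matrix ι κ R} {Q : Matrix κ ι R} (hPQ : P * Q = 1) (hQP : Q * P = 1) :
    Matrix κ κ R →* Matrix ι ι R where
  toFun B := P * B * Q
  map_one' := by rw [Matrix.mul_one, hPQ]
  map_mul' B B' := by
    have h : P * B * Q * (P * B' * Q) = P * B * (Q * P) * B' * Q := by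
      simp only [Matrix.mul_assoc]
    rw [h, hQP, Matrix.mul_one, Matrix.mul_assoc P B B']

theorem isEmbedding_conjHom [TopologicalSpace R] [IsTopologicalRing R] {P : Matrix ι κ R}
    {Q : Matrix κ ι R} (hPQ : P * Q = 1) (hQP : Q * P = 1) :
    Topology.IsEmbedding (conjHom hPQ hQP) := by
  refine Topology.IsEmbedding.of_leftInverse (f := fun A => Q * A * P) (fun B => ?_) ?_ ?_
  · change Q * (P * B * Q) * P = B
    calc Q * (P * B * Q) * P = (Q * P) * B * (Q * P) := by simp only [Matrix.mul_assoc]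
      _ = B := by rw [hQP, Matrix.one_mul, Matrix.mul_one]
  · exact (continuous_const.matrix_mul continuous_id).matrix_mul continuous_const
  · exact (continuous_const.matrix_mul continuous_id).matrix_mul continuous_const

variable {α : Type*} [Fintype α] [DecidableEq α] {m : α → Type*} [∀ a, Fintype (m a)]
  [∀ a, DecidableEq (m a)]

variable (R m) in
/-- The block diagonal embedding of a product of general linear groups. -/
def blockDiagonalGL : (∀ a, Matrix.GeneralLinearGroup (m a) R) →*
    Matrix.GeneralLinearGroup (Σ a, m a) R :=
  (Units.map (Matrix.blockDiagonal'RingHom m R).toMonoidHom).comp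
    MulEquiv.piUnits.symm.toMonoidHom

theorem isEmbedding_blockDiagonalGL [TopologicalSpace R] :
    Topology.IsEmbedding (blockDiagonalGL R m) := by
  refine Topology.IsEmbedding.comp (g := Units.map (Matrix.blockDiagonal'RingHom m R).toMonoidHom)
    (Topology.IsEmbedding.units_map ?_)
    (ContinuousMulEquiv.piUnits (M := fun a => Matrix (m a) (m a) R)).symm.toHomeomorph.isEmbedding
  exact Topology.IsEmbedding.of_leftInverse (f := Matrix.blockDiag')
    (fun M => Matrix.blockDiag'_blockDiagonal' M) continuous_id.matrix_blockDiag'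
    continuous_id.matrix_blockDiagonal'

end Topological

/-! ### The centralizer as a special product of diagonal groups. -/

section Centralizer

variable {n : ℕ}

theorem Ad_eq_iff_commute (g : SL n) (Z : sl n) : Ad g Z = Z ↔ Commute g.1.1 Z.1 := by
  rw [Subtype.ext_iff]
  change g.1.1 * Z.1 * (g.1⁻¹).1 = Z.1 ↔ g.1.1 * Z.1 = Z.1 * g.1.1
  exact Units.mul_inv_eq_iff_eq_mul _

theorem mem_centralizer_triple_iff {X H Y : sl n} (g : SL n) :
    g ∈ centralizer ({X, H, Y} : Set (sl n)) ↔
      Commute g.1.1 X.1 ∧ Commute g.1.1 H.1 ∧ Commute g.1.1 Y.1 := by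
  change (∀ Z ∈ ({X, H, Y} : Set (sl n)), Ad g Z = Z) ↔ _
  simp only [Set.mem_insert_iff, Set.mem_singleton_iff, forall_eq_or_imp, forall_eq,
    Ad_eq_iff_commute]

theorem mem_SL_iff (g : Matrix.GeneralLinearGroup (Fin n) ℍ[ℝ]) : g ∈ SL n ↔ nrd g.1 = 1 :=
  Iff.rfl

theorem mem_specialProd_iff {ι : Type*} [Fintype ι] {κ : ι → Type*} [∀ i, Fintype (κ i)]
    [∀ i, DecidableEq (κ i)] (G : ∀ i, Subgroup (Matrix.GeneralLinearGroup (κ i) ℍ[ℝ]))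
    (h : ∀ i, G i) : h ∈ specialProd G ↔ ∏ i, nrd (h i).1.1 = 1 := Iff.rfl

/-- The inclusion of the centralizer in the general linear group. -/
def centralizerToGL (S : Set (sl n)) : centralizer S →* Matrix.GeneralLinearGroup (Fin n) ℍ[ℝ] :=
  (SL n).subtype.comp (centralizer S).subtype

theorem isEmbedding_centralizerToGL (S : Set (sl n)) :
    Topology.IsEmbedding (centralizerToGL S) :=
  Topology.IsEmbedding.subtypeVal.comp Topology.IsEmbedding.subtypeVal

/-- The inclusion of `S(∏ᵢ Hᵢ)` in the product of the general linear groups. -/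
def specialProdToGL {ι : Type*} [Fintype ι] {κ : ι → Type*} [∀ i, Fintype (κ i)]
    [∀ i, DecidableEq (κ i)] (G : ∀ i, Subgroup (Matrix.GeneralLinearGroup (κ i) ℍ[ℝ])) :
    specialProd G →* ∀ i, Matrix.GeneralLinearGroup (κ i) ℍ[ℝ] where
  toFun h i := (h.1 i).1
  map_one' := rfl
  map_mul' _ _ := rfl

theorem isEmbedding_specialProdToGL {ι : Type*} [Fintype ι] {κ : ι → Type*} [∀ i, Fintype (κ i)]
    [∀ i, DecidableEq (κ i)] (G : ∀ i, Subgroup (Matrix.GeneralLinearGroup (κ i) ℍ[ℝ])) :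
    Topology.IsEmbedding (specialProdToGL G) :=
  (Topology.IsEmbedding.piMap fun i => Topology.IsEmbedding.subtypeVal (p := (· ∈ G i))).comp
    Topology.IsEmbedding.subtypeVal

/-- The diagonal copy `g ⊕ ⋯ ⊕ g` of an invertible matrix `g`. -/
def diagUnit (t d : ℕ) (u : (Matrix (Fin t) (Fin t) ℍ[ℝ])ˣ) : diagGL t d :=
  ⟨_, u, rfl⟩

theorem val_diagUnit (t d : ℕ) (u : (Matrix (Fin t) (Fin t) ℍ[ℝ])ˣ) :
    (diagUnit t d u).1.1 = Matrix.blockDiagonal fun _ => u.1 := rfl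

theorem exists_eq_diagUnit {t d : ℕ} (h : diagGL t d) : ∃ u, h = diagUnit t d u := by
  obtain ⟨_, u, rfl⟩ := h
  exact ⟨u, rfl⟩

/-- Because `d ≥ 1`, each block occurs at least once and can be read off from its copy of index `0`.
-/
theorem repeatedBlocks_injective {D : Finset ℕ} {t : ℕ → ℕ} (hD : ∀ d ∈ D, 1 ≤ d) :
    Function.Injective (repeatedBlocks (D := D) (t := t)) := by
  intro a a' h
  ext1 d
  have h1 := congrFun (Matrix.blockDiagonal'_injective h) d
  exact congrFun (Matrix.blockDiagonal_injective h1) ⟨0, hD d d.2⟩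

theorem repeatedBlocks_mul {D : Finset ℕ} {t : ℕ → ℕ}
    (a a' : ∀ d : D, Matrix (Fin (t d)) (Fin (t d)) ℍ[ℝ]) :
    repeatedBlocks a * repeatedBlocks a' = repeatedBlocks fun d => a d * a' d := by
  simp only [repeatedBlocks, ← Matrix.blockDiagonal'_mul, ← Matrix.blockDiagonal_mul]

theorem repeatedBlocks_one {D : Finset ℕ} {t : ℕ → ℕ} :
    repeatedBlocks (D := D) (t := t) (fun _ => 1) = 1 := by
  have : ∀ d : D, (Matrix.blockDiagonal fun _ : Fin d => (1 : Matrix (Fin (t d)) (Fin (t d)) ℍ[ℝ]))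
      = 1 := fun d => Matrix.blockDiagonal_one
  simp only [repeatedBlocks, this]
  exact Matrix.blockDiagonal'_one

/-- Both groups embed in `GL_n(ℍ)`, one by inclusion and the other by block matrices conjugated into
the string basis. It remains to compare the images. -/
theorem centralizer_continuousMulEquiv_specialProd {X H Y : sl n} (hT : IsSl2Triple H X Y)
    {D : Finset ℕ} {t : ℕ → ℕ} (hD : ∀ d ∈ D, 1 ≤ d)
    (ht : ∀ d, 1 ≤ d → Module.finrank (ℍ[ℝ])ᵐᵒᵖ (lowest X H Y d) = t d)
    (htD : ∀ d, d ∉ D → t d = 0) :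
    Nonempty (centralizer ({X, H, Y} : Set (sl n)) ≃ₜ*
      specialProd fun d : D => diagGL (t d) d) := by
  have hD' : ∀ d, 1 ≤ d → d ∉ D → lowest X H Y d = ⊥ := fun d hd hdD =>
    Submodule.finrank_eq_zero.1 ((ht d hd).trans (htD d hdD))
  let β : ∀ d : D, Module.Basis (Fin (t d)) (ℍ[ℝ])ᵐᵒᵖ (lowest X H Y d) := fun d =>
    Module.finBasisOfFinrankEq _ _ (ht d (hD d d.2))
  set P := basisMatrix (stringBasis β hT hD hD')
  set Q := coordMatrix (stringBasis β hT hD hD')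
  have hPQ : P * Q = 1 := basisMatrix_mul_coordMatrix _
  have hQP : Q * P = 1 := coordMatrix_mul_basisMatrix _
  have hmul : ∀ {A : Matrix (Fin n) (Fin n) ℍ[ℝ]}
      {B : Matrix (Σ d : D, Fin (t d) × Fin d) (Σ d : D, Fin (t d) × Fin d) ℍ[ℝ]},
      A * P = P * B → A = P * B * Q := by
    intro A B h
    rw [← h, Matrix.mul_assoc, hPQ, Matrix.mul_one]
  have hmul' : ∀ B : Matrix (Σ d : D, Fin (t d) × Fin d) (Σ d : D, Fin (t d) × Fin d) ℍ[ℝ],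
      P * B * Q * P = P * B := by
    intro B
    rw [Matrix.mul_assoc, hQP, Matrix.mul_one]
  let f : specialProd (fun d : D => diagGL (t d) d) →* Matrix.GeneralLinearGroup (Fin n) ℍ[ℝ] :=
    (Units.map (conjHom hPQ hQP)).comp ((blockDiagonalGL ℍ[ℝ] fun d : D => Fin (t d) × Fin d).comp
      (specialProdToGL _))
  have hf : Topology.IsEmbedding f :=
    (isEmbedding_conjHom hPQ hQP).units_map.comp
      (isEmbedding_blockDiagonalGL.comp (isEmbedding_specialProdToGL _))
  have hfval : ∀ h, (f h).1 = P * (Matrix.blockDiagonal' fun d => (h.1 d).1.1) * Q := fun h => rfl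
  refine nonempty_continuousMulEquiv_of_range_eq (isEmbedding_centralizerToGL _) hf ?_
  ext g
  constructor
  · rintro ⟨c, rfl⟩
    obtain ⟨hcX, hcH, hcY⟩ := (mem_centralizer_triple_iff c.1).1 c.2
    -- The blocks of `c⁻¹` serve as inverses of the blocks of `c`, so that the latter are units.
    obtain ⟨hdX, hdH, hdY⟩ := (mem_centralizer_triple_iff (c⁻¹).1).1 (c⁻¹).2
    obtain ⟨a, ha⟩ := exists_repeatedBlocks_of_commute β hT hD hD' hcX hcH hcY
    obtain ⟨a', ha'⟩ := exists_repeatedBlocks_of_commute β hT hD hD' hdX hdH hdY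
    have inv : ∀ {A A' : Matrix (Fin n) (Fin n) ℍ[ℝ]}
        {a a' : ∀ d : D, Matrix (Fin (t d)) (Fin (t d)) ℍ[ℝ]}, A * A' = 1 →
        A * P = P * repeatedBlocks a → A' * P = P * repeatedBlocks a' → ∀ d, a d * a' d = 1 := by
      intro A A' a a' h h1 h2
      refine congrFun (repeatedBlocks_injective hD ?_)
      rw [← repeatedBlocks_mul, repeatedBlocks_one, ← hQP]
      have : P = P * (repeatedBlocks a * repeatedBlocks a') := by
        calc P = A * A' * P := by rw [h, Matrix.one_mul]
          _ = P * (repeatedBlocks a * repeatedBlocks a') := by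
            rw [Matrix.mul_assoc, h2, ← Matrix.mul_assoc, h1, Matrix.mul_assoc]
      conv_rhs => rw [this]
      rw [← Matrix.mul_assoc, hQP, Matrix.one_mul]
    have h1 := inv (Units.mul_inv c.1.1) ha ha'
    have h2 := inv (Units.inv_mul c.1.1) ha' ha
    let h : ∀ d : D, diagGL (t d) d := fun d => diagUnit _ _ ⟨a d, a' d, h1 d, h2 d⟩
    have hh : (Matrix.blockDiagonal' fun d => (h d).1.1) = repeatedBlocks a := rfl
    have hmem : h ∈ specialProd fun d : D => diagGL (t d) d := by
      rw [mem_specialProd_iff, ← nrd_blockDiagonal', hh, ← nrd_conj_of_mul_eq_one hPQ hQP,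
        ← hmul ha]
      exact c.1.2
    refine ⟨⟨h, hmem⟩, Units.ext ?_⟩
    rw [hfval, hh, ← hmul ha]
    rfl
  · rintro ⟨h, rfl⟩
    choose u hu using fun d => exists_eq_diagUnit (h.1 d)
    have hblock : (Matrix.blockDiagonal' fun d => (h.1 d).1.1)
        = repeatedBlocks fun d : D => (u d).1 := by
      simp only [hu, val_diagUnit]
      rfl
    have hSL : f h ∈ SL n := by
      rw [mem_SL_iff, hfval, nrd_conj_of_mul_eq_one hPQ hQP, nrd_blockDiagonal']
      exact h.2
    refine ⟨⟨⟨f h, hSL⟩, (mem_centralizer_triple_iff _).2 ?_⟩, rfl⟩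
    refine commute_of_mul_basisMatrix_eq β hT hD hD' (a := fun d => (u d).1) ?_
    rw [← hblock]
    exact hmul' _

end Centralizer

end QuaternionicNilpotent

end

theorem mainTheorem9 (n : ℕ) (X H Y : QuaternionicNilpotent.sl n)
    (hX0 : X ≠ 0)
    (hXnil : IsNilpotent (LieAlgebra.ad ℝ (QuaternionicNilpotent.sl n) X))
    (hT : IsSl2Triple H X Y)
    (p : n.Partition) (hp : QuaternionicNilpotent.CorrespondsTo (QuaternionicNilpotent.orbit X) p) :
    Nonempty ((QuaternionicNilpotent.centralizer ({X, H, Y} : Set (QuaternionicNilpotent.sl n))) ≃ₜ*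
      (QuaternionicNilpotent.specialProd (fun d : p.parts.toFinset =>
        QuaternionicNilpotent.diagGL (p.parts.count (d : ℕ)) (d : ℕ)))) := by
  refine QuaternionicNilpotent.centralizer_continuousMulEquiv_specialProd hT
    (t := fun d => p.parts.count d) (fun d hd => p.parts_pos (Multiset.mem_toFinset.1 hd)) ?_
    fun d hd => Multiset.count_eq_zero.2 fun h => hd (Multiset.mem_toFinset.2 h)
  rcases hp with ⟨⟨g, hg⟩, -⟩ | ⟨X', ⟨g, hg⟩, H', Y', hT', h⟩
  -- If `0` lies in the orbit of `X`, conjugating back gives `X = 0`.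
  · refine absurd ?_ hX0
    rw [← QuaternionicNilpotent.Ad_one X, ← inv_mul_cancel g, QuaternionicNilpotent.Ad_mul, hg]
    ext1
    simp [QuaternionicNilpotent.Ad]
  -- The partition was computed from a triple on a conjugate of `X`; the multiplicities agree with
  -- those of the given triple.
  · intro d hd
    rw [h d hd]
    exact (QuaternionicNilpotent.finrank_lowest_eq_of_conj hT hT' g hg hd).symm
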